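/- **Theorem 4.4.** Let $M$ be a 3-dimensional unimodular Lie group with a left invariant Riemannian metric, and let $E_1,E_2,E_3$ be a positively oriented orthonormal basis of its Lie algebra with $$[E_2,E_3]=c_1E_1,\qquad [E_3,E_1]=c_2E_2,\qquad [E_1,E_2]=c_3E_3 ,$$ extended to a left invariant frame. Put $\mu_1=\frac{-c_1+c_2+c_3}{2}$, $\mu_2=\frac{c_1-c_2+c_3}{2}$, $\mu_3=\frac{c_1+c_2-c_3}{2}$, and assume $\mu_1=\mu_2$. Let $\varphi:\Sigma\to M$ be an oriented isometric immersion of a surface with smooth unit normal field $N$, let $N_i=\langle N,E_i\circ\varphi\rangle$, and let $g=\dfrac{N_1+iN_2}{1-N_3}:\Sigma\to\mathbb C\cup\{\infty\}$ be its Gauss map. Assume that the extrinsic curvature $K$ (the determinant of the shape operator) is negative and that, on $\Sigma$, $$K\neq-\mu_1^2,\qquad K\neq-\frac{\big((-1+|g|^2)^2\mu_1+4|g|^2\mu_3\big)^2}{(1+|g|^2)^4}$$ (where $g=\infty$ the second condition is read as its limit, which is the first one). Let $(u,v)$ be proper null coordinates for the second fundamental form, with $N$ compatible with them: $\langle -dN,d\varphi\rangle=2\mathbf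 f\,du\,dv$ with $\mathbf f>0$, where $-dN$ stands for $-\nabla N$, and $(\varphi_u,\varphi_v,N)$ is positively oriented. Then at every point of the coordinate domain with $g\ne\infty$, $$g_{uv}= \mathbf G_1 g_u g_v+ \mathbf G_2 g_u \overline g_v+ \mathbf G_3 \overline g_u g_v+ \mathbf G_4 \overline g_u\overline g_v+\mathbf G_5 K_u g_v+ \mathbf G_6 K_u \overline g_v+\mathbf G_7 K_v g_u + \mathbf G_8 K_v \overline g_u ,$$ where $\mathbf G_i=G_i(K)$ and the functions $G_i$ are the following. Write $t=|g|^2$, $B=1+t$, $P_{(m_0,\dots,m_4)}=\sum_{i=0}^4m_it^i$, $Q=P_{(\mu_1,4\mu_3-2\mu_1,\mu_1,0,0)}$, and $\sqrt x=i\sqrt{-x}$ for $x<0$. Then $$G_1(x)=\frac{2\overline g\,\mathcal N(x)}{B^3\Big(B^4x^2+\mu_1^2\big((B-2)^2\mu_1+4t\mu_3\big)^2+2x\big(P_{(1,0,6,0,1)}\mu_1^2+P_{(0,4,-8,4,0)}\mu_1\mu_3+8t^2\mu_3^2\big)\Big)},$$ $$\begin{aligned}\mathcal N(x)={}&B^6x^2+2B^2x\big(P_{(0,4,2,1,1)}\mu_1^2+P_{(1,-5,1,3,0)}\mu_1\mu_3+P_{(0,5,3,0,0)}\mu_3^2\big)+16t^2(B-2)\mu_1\mu_3^3\\&-\mu_1\Big(\big(1+6t-t^2P_{(13,-10,3,0,1)}\big)\mu_1^3-2(B-2)P_{(-1,-6,18,2,3)}\mu_1^2\mu_3-P_{(0,2,66,-18,14)}\mu_1\mu_3^2\Big),\end{aligned}$$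 $$G_2(x)=\frac{2ig(B-2)(\mu_3-\mu_1)\big(2B^4x^2+B^4x\mu_1^2-iB^2\sqrt x\,(x+\mu_1^2)P_{(\mu_1,2\mu_3,\mu_1,0,0)}-\mu_1^2Q^2\big)}{B^3\sqrt x\,(x+\mu_1^2)(B^4x+Q^2)},$$ $$G_3(x)=\frac{2ig(B-2)(\mu_1-\mu_3)\big(2B^4x^2+B^4x\mu_1^2+iB^2\sqrt x\,(x+\mu_1^2)P_{(\mu_1,2\mu_3,\mu_1,0,0)}-\mu_1^2Q^2\big)}{B^3\sqrt x\,(x+\mu_1^2)(B^4x+Q^2)},$$ $$G_4(x)=-\frac{4g^3(B-2)(\mu_1-\mu_3)^2\big(-3B^2x+P_{(\mu_1^2,\,8\mu_1\mu_3-6\mu_1^2,\,\mu_1^2,0,0)}\big)}{B^3(x+\mu_1^2)(B^4x+Q^2)},$$ $$G_5(x)=\frac{B^2x+\mu_1Q}{4x(\sqrt x+i\mu_1)(B^2\sqrt x+iQ)},\qquad G_7(x)=\frac{B^2x+\mu_1Q}{4x(\sqrt x-i\mu_1)(B^2\sqrt x-iQ)},$$ $$G_6(x)=\frac{-ig^2(\mu_1-\mu_3)}{\sqrt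 x(\sqrt x+i\mu_1)(B^2\sqrt x+iQ)},\qquad G_8(x)=\frac{ig^2(\mu_1-\mu_3)}{\sqrt x(\sqrt x-i\mu_1)(B^2\sqrt x-iQ)} .$$ -/

import Mathlib

open scoped Manifold ContDiff
open Bundle

noncomputable section

namespace UnimodularSurface

/-! ### Left invariant metrics, frames and the Levi-Civita connection -/

section Ambient

variable {M : Type*} [TopologicalSpace M] [ChartedSpace (EuclideanSpace ℝ (Fin 3)) M]
  [Group M] [LieGroup (𝓡 3) ∞ M]

/-- A smooth Riemannian metric on the three-dimensional Lie group `M`. -/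
abbrev Metric (M : Type*) [TopologicalSpace M] [ChartedSpace (EuclideanSpace ℝ (Fin 3)) M]
    [Group M] [LieGroup (𝓡 3) ∞ M] :=
  ContMDiffRiemannianMetric (𝓡 3) ∞ (EuclideanSpace ℝ (Fin 3))
    (fun q : M => TangentSpace (𝓡 3) q)

/-- Left translations are isometries of the metric. -/
def IsLeftInvariant (m : Metric M) : Prop :=
  ∀ (q : M) (X Y : GroupLieAlgebra (𝓡 3) M),
    m.inner q (mulInvariantVectorField X q) (mulInvariantVectorField Y q) = m.inner 1 X Y

/-- `E` is an orthonormal basis of the Lie algebra with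
`[E₂,E₃] = c₁ E₁`, `[E₃,E₁] = c₂ E₂`, `[E₁,E₂] = c₃ E₃` (indices are shifted by one in the code).
Equivalently, for the cross product `×` of the orientation in which `E` is positive, the
endomorphism `L` with `L (X × Y) = [X, Y]` is diagonal in `E`; an orthonormal basis of this kind
exists if and only if `L` is self-adjoint, that is, if and only if `M` is unimodular. -/
structure IsUnimodularFrame (m : Metric M) (E : Fin 3 → GroupLieAlgebra (𝓡 3) M)
    (c : Fin 3 → ℝ) : Prop where
  orthonormal : ∀ i j, m.inner 1 (E i) (E j) = if i = j then 1 else 0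
  lie_one_two : ⁅E 1, E 2⁆ = c 0 • E 0
  lie_two_zero : ⁅E 2, E 0⁆ = c 1 • E 1
  lie_zero_one : ⁅E 0, E 1⁆ = c 2 • E 2

/-- The constants `μ₁, μ₂, μ₃` (as `mu c 0`, `mu c 1`, `mu c 2`). -/
def mu (c : Fin 3 → ℝ) : Fin 3 → ℝ :=
  ![(-c 0 + c 1 + c 2) / 2, (c 0 - c 1 + c 2) / 2, (c 0 + c 1 - c 2) / 2]

/-- The components `⟨v, Eᵢ(q)⟩` of a tangent vector `v` at `q`, where `Eᵢ(q)` is the left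
invariant vector field with value `Eᵢ` at the identity. -/
def comp (m : Metric M) (E : Fin 3 → GroupLieAlgebra (𝓡 3) M) (q : M)
    (v : TangentSpace (𝓡 3) q) : Fin 3 → ℝ :=
  fun i => m.inner q v (mulInvariantVectorField (E i) q)

/-- The Christoffel symbols `Γᵢⱼᵏ = ⟨∇_{Eᵢ} Eⱼ, E_k⟩` of the Levi-Civita connection of a left
invariant metric in the left invariant orthonormal frame with value `E` at the identity, given by
the Koszul formula (in which the derivatives of the constant functions `⟨Eᵢ, Eⱼ⟩` vanish). -/
def christoffel (m : Metric M) (E : Fin 3 → GroupLieAlgebra (𝓡 3) M) (i j k : Fin 3) : ℝ :=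
  (m.inner 1 ⁅E i, E j⁆ (E k) - m.inner 1 ⁅E j, E k⁆ (E i) + m.inner 1 ⁅E k, E i⁆ (E j)) / 2

end Ambient

/-! ### Surfaces -/

section Surface

variable {M : Type*} [TopologicalSpace M] [ChartedSpace (EuclideanSpace ℝ (Fin 3)) M]
  [Group M] [LieGroup (𝓡 3) ∞ M]
  {S : Type*} [TopologicalSpace S] [ChartedSpace (EuclideanSpace ℝ (Fin 2)) S]

/-- `φ : S → M` is a smooth immersion and `N` is a smooth unit normal vector field along `φ`.
The surface `S` carries the metric induced by `φ`. -/
structure IsImmersionWithNormal (m : Metric M) (φ : S → M)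
    (N : ∀ p : S, TangentSpace (𝓡 3) (φ p)) : Prop where
  contMDiff : ContMDiff (𝓡 2) (𝓡 3) ∞ φ
  injective_mfderiv : ∀ p, Function.Injective (mfderiv (𝓡 2) (𝓡 3) φ p)
  contMDiff_normal : ContMDiff (𝓡 2) (𝓡 3).tangent ∞
    (fun p => (⟨φ p, N p⟩ : TangentBundle (𝓡 3) M))
  unit : ∀ p, m.inner (φ p) (N p) (N p) = 1
  normal : ∀ p (w : TangentSpace (𝓡 2) p), m.inner (φ p) (N p) (mfderiv (𝓡 2) (𝓡 3) φ p w) = 0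

variable (m : Metric M) (E : Fin 3 → GroupLieAlgebra (𝓡 3) M) (φ : S → M)
  (N : ∀ p : S, TangentSpace (𝓡 3) (φ p))

/-- The components `a₁, a₂, a₃` of `dφ(w)` in the left invariant frame. -/
def tangentComp (p : S) (w : TangentSpace (𝓡 2) p) : Fin 3 → ℝ :=
  comp m E (φ p) (mfderiv (𝓡 2) (𝓡 3) φ p w)

/-- The Gauss map `Nᵉ = (N₁, N₂, N₃)`, with values in the unit sphere of the Lie algebra. -/
def normalComp (p : S) : Fin 3 → ℝ := comp m E (φ p) (N p)

/-- The Gauss map `g = (N₁ + i N₂) / (1 - N₃)` after stereographic projection from the north pole.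
It is meaningful where `N₃ ≠ 1`; the points with `N₃ = 1` are those with `g = ∞`. -/
def gaussMap (p : S) : ℂ :=
  ((normalComp m E φ N p 0 : ℂ) + Complex.I * (normalComp m E φ N p 1 : ℂ)) /
    (1 - (normalComp m E φ N p 2 : ℂ))

/-- The components in the left invariant frame of the covariant derivative `∇_{dφ(w)} N`:
`w(N_k) + ∑ᵢⱼ aᵢ Nⱼ Γᵢⱼᵏ`. -/
def covNormal (p : S) (w : TangentSpace (𝓡 2) p) : Fin 3 → ℝ := fun k =>
  mvfderiv (𝓡 2) (fun p' : S => normalComp m E φ N p' k) p w +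
    ∑ i, ∑ j, tangentComp m E φ p w i * normalComp m E φ N p j * christoffel m E i j k

/-- The first fundamental form `I(w, w') = ⟨dφ(w), dφ(w')⟩`. -/
def firstForm (p : S) (w w' : TangentSpace (𝓡 2) p) : ℝ :=
  m.inner (φ p) (mfderiv (𝓡 2) (𝓡 3) φ p w) (mfderiv (𝓡 2) (𝓡 3) φ p w')

/-- The second fundamental form `II(w, w') = -⟨∇_{dφ(w)} N, dφ(w')⟩`. -/
def secondForm (p : S) (w w' : TangentSpace (𝓡 2) p) : ℝ :=
  -∑ k, covNormal m E φ N p w k * tangentComp m E φ p w' k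

/-- The standard basis of the model plane, also used as a basis of each `T_p S`. -/
def e (i : Fin 2) : EuclideanSpace ℝ (Fin 2) := EuclideanSpace.single i 1

/-- The matrix `I⁻¹ II` of the shape operator at `p` in a basis of `T_p S`. -/
def shapeMatrix (p : S) : Matrix (Fin 2) (Fin 2) ℝ :=
  (Matrix.of fun i j : Fin 2 => firstForm m φ p (e i) (e j))⁻¹ *
    Matrix.of fun i j : Fin 2 => secondForm m E φ N p (e i) (e j)

/-- The extrinsic curvature: the determinant of the shape operator. -/
def extrinsicCurvature (p : S) : ℝ := (shapeMatrix m E φ N p).det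

/-- The coordinate vector fields `∂_u` (`i = 0`) and `∂_v` (`i = 1`) of a chart `(u, v)` of `S`,
at the point with coordinates `x`. -/
def coordVec (c : OpenPartialHomeomorph S (EuclideanSpace ℝ (Fin 2)))
    (x : EuclideanSpace ℝ (Fin 2)) (i : Fin 2) : TangentSpace (𝓡 2) (c.symm x) :=
  mfderiv (𝓡 2) (𝓡 2) c.symm x (e i)

/-- `(u, v) = c` is a smooth chart of `S` giving proper null coordinates for the second
fundamental form, and `N` is compatible with it: `II = 2 f du dv` with `f > 0`, and the coordinates
are positively oriented, that is, `(φ_u, φ_v, N)` is a positive basis (the orientation of `M` is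
the one in which the frame `E` is positive). -/
structure IsProperNullChart (c : OpenPartialHomeomorph S (EuclideanSpace ℝ (Fin 2))) : Prop where
  mem_maximalAtlas : c ∈ IsManifold.maximalAtlas (𝓡 2) ∞ S
  null_u : ∀ x ∈ c.target,
    secondForm m E φ N (c.symm x) (coordVec c x 0) (coordVec c x 0) = 0
  null_v : ∀ x ∈ c.target,
    secondForm m E φ N (c.symm x) (coordVec c x 1) (coordVec c x 1) = 0
  compatible : ∀ x ∈ c.target,
    0 < secondForm m E φ N (c.symm x) (coordVec c x 0) (coordVec c x 1)
  oriented : ∀ x ∈ c.target,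
    0 < Matrix.det (Matrix.of ![tangentComp m E φ (c.symm x) (coordVec c x 0),
      tangentComp m E φ (c.symm x) (coordVec c x 1), normalComp m E φ N (c.symm x)])

end Surface

/-- The partial derivatives `f_u` (`i = 0`) and `f_v` (`i = 1`) of a function of `(u, v)`. -/
def pd {F : Type*} [NormedAddCommGroup F] [NormedSpace ℝ F] (i : Fin 2)
    (f : EuclideanSpace ℝ (Fin 2) → F) (x : EuclideanSpace ℝ (Fin 2)) : F :=
  fderiv ℝ f x (e i)

/-! ### The coefficient functions -/

/-! Throughout, `μ₁ = μ₂`, and `x` is the value of the extrinsic curvature. -/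

/-- `P_{(m₀,m₁,m₂,m₃,m₄)} = ∑ᵢ mᵢ |g|²ⁱ`. -/
def P (g : ℂ) (m₀ m₁ m₂ m₃ m₄ : ℝ) : ℂ :=
  m₀ + m₁ * Complex.normSq g + m₂ * (Complex.normSq g) ^ 2 + m₃ * (Complex.normSq g) ^ 3 +
    m₄ * (Complex.normSq g) ^ 4

/-- `B = 1 + |g|²`. -/
def B (g : ℂ) : ℂ := 1 + Complex.normSq g

/-- `Q = P_{(μ₁, 4μ₃ - 2μ₁, μ₁, 0, 0)}`. -/
def Q (μ₁ μ₃ : ℝ) (g : ℂ) : ℂ := P g μ₁ (4 * μ₃ - 2 * μ₁) μ₁ 0 0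

/-- The principal square root of a real number, `i √(-x)` for `x < 0`. -/
def rt (x : ℝ) : ℂ := (Real.sqrt x : ℂ) + Complex.I * (Real.sqrt (-x) : ℂ)

open Complex in
/-- The coefficient function `G₁`. -/
def G₁ (μ₁ μ₃ : ℝ) (g : ℂ) (x : ℝ) : ℂ :=
  2 * star g *
    (B g ^ 6 * x ^ 2
      + 2 * B g ^ 2 * x * (P g 0 4 2 1 1 * μ₁ ^ 2 + P g 1 (-5) 1 3 0 * μ₁ * μ₃
        + P g 0 5 3 0 0 * μ₃ ^ 2)
      + 16 * (normSq g : ℂ) ^ 2 * (B g - 2) * μ₁ * μ₃ ^ 3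
      - μ₁ * ((1 + 6 * (normSq g : ℂ) - (normSq g : ℂ) ^ 2 * P g 13 (-10) 3 0 1) * μ₁ ^ 3
        - 2 * (B g - 2) * P g (-1) (-6) 18 2 3 * μ₁ ^ 2 * μ₃
        - P g 0 2 66 (-18) 14 * μ₁ * μ₃ ^ 2)) /
  (B g ^ 3 * (B g ^ 4 * x ^ 2 + μ₁ ^ 2 * ((B g - 2) ^ 2 * μ₁ + 4 * (normSq g : ℂ) * μ₃) ^ 2
    + 2 * x * (P g 1 0 6 0 1 * μ₁ ^ 2 + P g 0 4 (-8) 4 0 * μ₁ * μ₃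
      + 8 * (normSq g : ℂ) ^ 2 * μ₃ ^ 2)))

open Complex in
/-- The coefficient function `G₂`. -/
def G₂ (μ₁ μ₃ : ℝ) (g : ℂ) (x : ℝ) : ℂ :=
  2 * I * g * (B g - 2) * (μ₃ - μ₁) *
    (2 * B g ^ 4 * x ^ 2 + B g ^ 4 * x * μ₁ ^ 2
      - I * B g ^ 2 * rt x * (x + μ₁ ^ 2) * P g μ₁ (2 * μ₃) μ₁ 0 0
      - μ₁ ^ 2 * Q μ₁ μ₃ g ^ 2) /
  (B g ^ 3 * rt x * (x + μ₁ ^ 2) * (B g ^ 4 * x + Q μ₁ μ₃ g ^ 2))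

open Complex in
/-- The coefficient function `G₃`. -/
def G₃ (μ₁ μ₃ : ℝ) (g : ℂ) (x : ℝ) : ℂ :=
  2 * I * g * (B g - 2) * (μ₁ - μ₃) *
    (2 * B g ^ 4 * x ^ 2 + B g ^ 4 * x * μ₁ ^ 2
      + I * B g ^ 2 * rt x * (x + μ₁ ^ 2) * P g μ₁ (2 * μ₃) μ₁ 0 0
      - μ₁ ^ 2 * Q μ₁ μ₃ g ^ 2) /
  (B g ^ 3 * rt x * (x + μ₁ ^ 2) * (B g ^ 4 * x + Q μ₁ μ₃ g ^ 2))

/-- The coefficient function `G₄`. -/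
def G₄ (μ₁ μ₃ : ℝ) (g : ℂ) (x : ℝ) : ℂ :=
  -(4 * g ^ 3 * (B g - 2) * (μ₁ - μ₃) ^ 2 *
    (-3 * B g ^ 2 * x + P g (μ₁ ^ 2) (8 * μ₁ * μ₃ - 6 * μ₁ ^ 2) (μ₁ ^ 2) 0 0)) /
  (B g ^ 3 * (x + μ₁ ^ 2) * (B g ^ 4 * x + Q μ₁ μ₃ g ^ 2))

open Complex in
/-- The coefficient function `G₅`. -/
def G₅ (μ₁ μ₃ : ℝ) (g : ℂ) (x : ℝ) : ℂ :=
  (B g ^ 2 * x + μ₁ * Q μ₁ μ₃ g) /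
    (4 * x * (rt x + I * μ₁) * (B g ^ 2 * rt x + I * Q μ₁ μ₃ g))

open Complex in
/-- The coefficient function `G₆`. -/
def G₆ (μ₁ μ₃ : ℝ) (g : ℂ) (x : ℝ) : ℂ :=
  -(I * g ^ 2 * (μ₁ - μ₃)) /
    (rt x * (rt x + I * μ₁) * (B g ^ 2 * rt x + I * Q μ₁ μ₃ g))

open Complex in
/-- The coefficient function `G₇`: `G₅` with its coefficients conjugated and `rt x` kept; it is the
complex conjugate of `G₅` for `x > 0`. -/
def G₇ (μ₁ μ₃ : ℝ) (g : ℂ) (x : ℝ) : ℂ :=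
  (B g ^ 2 * x + μ₁ * Q μ₁ μ₃ g) /
    (4 * x * (rt x - I * μ₁) * (B g ^ 2 * rt x - I * Q μ₁ μ₃ g))

open Complex in
/-- The coefficient function `G₈`. -/
def G₈ (μ₁ μ₃ : ℝ) (g : ℂ) (x : ℝ) : ℂ :=
  I * g ^ 2 * (μ₁ - μ₃) /
    (rt x * (rt x - I * μ₁) * (B g ^ 2 * rt x - I * Q μ₁ μ₃ g))

end UnimodularSurface

end

/-! Read everything in the left invariant frame: `n` is the unit normal and `a`, `b` are φ_u, φ_v,
so all three are maps from the plane to ℝ³. Covariant differentiation of the normal along `a` adds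
(μ a) × n to the derivative of `n` (`christoffel_sum`). In null coordinates ∇_u N is orthogonal to
φ_u and to N, hence equals ρ a × n; likewise ∇_v N = -ρ b × n, with the same ρ > 0 because the
second fundamental form is symmetric. Thus n_u = ((ρ - μ) a) × n and n_v = ((-ρ - μ) b) × n
(`null_chart_eqs`), while K = -ρ² (`extrinsicCurvature_eq_neg_sq`). The symmetry of second
derivatives of the immersion gives a_v - b_u = c (a × b) (`maurer_cartan`, `curl_tangentComp`).

Stereographic projection turns `a`, `b` into complex functions `al`, `be`, and the equations for `n`
become g_u = i W_ρ(al), g_v = i W_{-ρ}(be), where the real-linear operator W_r is `weingarten`; the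
rotational symmetry μ₁ = μ₂ gives it its short form. Differentiating the first equation in v and the
second in u yields two expressions for g_uv, containing the unknowns al_v and be_u. Their difference
is known from the curl equation (`curl_stereographic`), and W_ρ - W_{-ρ} = 2ρ, so both unknowns can
be eliminated (`mixedDeriv_of_two_expressions`).

The determinant of W_r is (r - μ₁)(r - Q/B²), and the product of those of W_ρ and W_{-ρ} is (K +
μ₁²)(B⁴K + Q²)/B⁴. The two conditions on K therefore say that W_ρ and W_{-ρ} are invertible, so `al`
and `be` are determined by g_u and g_v. In these terms the part bilinear in `al`, `be` gives G₁ to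
G₄ (`quadratic_part_eq`), and the terms in ρ_u, ρ_v give G₅ to G₈ (`weingarten_div_eq`), since K_u =
-2ρ ρ_u and K_v = -2ρ ρ_v. In the algebraic lemmas a number and its conjugate are independent
letters, which makes every claim an identity of rational functions. -/

noncomputable section

namespace UnimodularSurface

/-! ### Partial derivatives -/

section

open Complex ComplexConjugate

section PartialDerivatives

variable {i : Fin 2} {x : EuclideanSpace ℝ (Fin 2)} {f h : EuclideanSpace ℝ (Fin 2) → ℂ}

lemma pd_congr {F : Type*} [NormedAddCommGroup F] [NormedSpace ℝ F]
    {f h : EuclideanSpace ℝ (Fin 2) → F} (hfh : f =ᶠ[nhds x] h) : pd i f x = pd i h x := by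
  rw [pd, pd, hfh.fderiv_eq]

lemma pd_mul (hf : DifferentiableAt ℝ f x) (hh : DifferentiableAt ℝ h x) :
    pd i (fun y => f y * h y) x = f x * pd i h x + pd i f x * h x := by
  simp only [pd]
  rw [fderiv_fun_mul hf hh]
  simp [mul_comm]

lemma pd_add (hf : DifferentiableAt ℝ f x) (hh : DifferentiableAt ℝ h x) :
    pd i (fun y => f y + h y) x = pd i f x + pd i h x := by
  simp only [pd]
  rw [fderiv_fun_add hf hh]
  rfl

lemma pd_sub (hf : DifferentiableAt ℝ f x) (hh : DifferentiableAt ℝ h x) :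
    pd i (fun y => f y - h y) x = pd i f x - pd i h x := by
  simp only [pd]
  rw [fderiv_fun_sub hf hh]
  rfl

lemma pd_const (z : ℂ) : pd i (fun _ => z) x = 0 := by
  simp [pd]

lemma pd_conj (hf : DifferentiableAt ℝ f x) :
    pd i (fun y => conj (f y)) x = conj (pd i f x) := by
  have := (conjCLE.hasFDerivAt (x := f x)).comp x hf.hasFDerivAt
  exact congrArg (fun l => l (e i)) this.fderiv

lemma pd_ofReal {f : EuclideanSpace ℝ (Fin 2) → ℝ} (hf : DifferentiableAt ℝ f x) :
    pd i (fun y => (f y : ℂ)) x = pd i f x := by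
  have := (ofRealCLM.hasFDerivAt (x := f x)).comp x hf.hasFDerivAt
  exact congrArg (fun l => l (e i)) this.fderiv

lemma pd_neg_sq {f : EuclideanSpace ℝ (Fin 2) → ℝ} (hf : DifferentiableAt ℝ f x) :
    pd i (fun y => -(f y) ^ 2) x = -2 * f x * pd i f x := by
  simp only [pd]
  rw [fderiv_fun_neg, fderiv_fun_pow 2 hf]
  simp

lemma pd_apply {i : Fin 2} {x : EuclideanSpace ℝ (Fin 2)} {f : EuclideanSpace ℝ (Fin 2) → Fin 3 → ℝ}
    (hf : DifferentiableAt ℝ f x) (k : Fin 3) :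
    pd i (fun y => f y k) x = pd i f x k := by
  simp only [pd]
  rw [fderiv_apply (by fun_prop)]
  simp

/-- Mixed partial derivatives of a `C²` function agree. -/
lemma pd_comm {F : Type*} [NormedAddCommGroup F] [NormedSpace ℝ F]
    {f : EuclideanSpace ℝ (Fin 2) → F} (hf : ContDiffAt ℝ 2 f x) (i j : Fin 2) :
    pd i (pd j f) x = pd j (pd i f) x := by
  have hd : DifferentiableAt ℝ (fderiv ℝ f) x :=
    (hf.fderiv_right (m := 1) (by norm_num)).differentiableAt (by norm_num)
  have key (i j : Fin 2) : pd i (pd j f) x = fderiv ℝ (fderiv ℝ f) x (e i) (e j) := by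
    change fderiv ℝ (fun y => fderiv ℝ f y (e j)) x (e i) = _
    rw [fderiv_clm_apply hd (differentiableAt_const _)]
    simp
  rw [key, key]
  exact (hf.isSymmSndFDerivAt (by simp)).eq _ _

lemma contDiffAt_pd {F : Type*} [NormedAddCommGroup F] [NormedSpace ℝ F]
    {f : EuclideanSpace ℝ (Fin 2) → F} (hf : ContDiffAt ℝ 2 f x) (i : Fin 2) :
    ContDiffAt ℝ 1 (pd i f) x :=
  (hf.fderiv_right (m := 1) (by norm_num)).clm_apply contDiffAt_const

end PartialDerivatives

lemma dotProduct_fin_three (u v : Fin 3 → ℝ) :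
    u ⬝ᵥ v = u 0 * v 0 + u 1 * v 1 + u 2 * v 2 := by
  simp [dotProduct, Fin.sum_univ_three]

end

section

open Complex ComplexConjugate

/-! ### Algebra in the stereographic coordinate

Below `g` is the stereographic coordinate of the point `n` of the unit sphere, `s` is its conjugate,
`al` and `be` are the images of tangent vectors `a` and `b` under the differential of the
stereographic projection, with conjugates `as` and `bs`, and `d` stands for `μ₁ - μ₃`. -/

/-- The map `X ↦ ((r - μ) X) × n` on tangent vectors of the sphere, where `μ` is the diagonal matrix
with entries `m, m, m - d`, reads `w ↦ I * weingarten g s d r m w ws` in the stereographic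
coordinate; `ws` is the conjugate of `w`. -/
def weingarten (g s d r m w ws : ℂ) : ℂ :=
  (r - m) * w + 2 * d * g / (1 + g * s) ^ 2 * (w * s + g * ws)

/-- The derivative of `g ↦ 2 * (al * s + g * as) / (1 + g * s) ^ 2 * g` in the direction `w`, with
`al` and its conjugate `as` fixed. -/
def weingartenVariation (g s al as w ws : ℂ) : ℂ :=
  (2 * (al * ws + w * as) / (1 + g * s) ^ 2
    - 4 * (al * s + g * as) * (w * s + g * ws) / (1 + g * s) ^ 3) * g
    + 2 * (al * s + g * as) / (1 + g * s) ^ 2 * w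

/-- The value of `al_v - be_u` dictated by the structure equations. -/
def curlTerm (g s d r al as be bs : ℂ) : ℂ :=
  -(4 * I * r * s / (1 + g * s)) * al * be + 2 * I * d * g / (1 + g * s) ^ 2 * (al * bs - as * be)

/-- The conjugate of `curlTerm`. -/
def curlTermConj (g s d r al as be bs : ℂ) : ℂ :=
  4 * I * r * g / (1 + g * s) * as * bs - 2 * I * d * s / (1 + g * s) ^ 2 * (as * be - al * bs)

/-- Two expressions for `w = g_uv`, one in terms of `al_v` and one in terms of `be_u`, determine `w`
once `al_v - be_u` is known. -/
lemma mixedDeriv_of_two_expressions {g s al as be bs gu us gv vs w alv alvs beu beus : ℂ}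
    {r ru rv d m : ℂ} (hr : r ≠ 0)
    (h1 : w = I * (rv * al + weingarten g s d r m alv alvs
      + d * weingartenVariation g s al as gv vs))
    (h2 : w = I * (-ru * be + weingarten g s d (-r) m beu beus
      + d * weingartenVariation g s be bs gu us))
    (h12 : rv * as + weingarten s g d r m alvs alv + d * weingartenVariation s g as al vs gv
      = -ru * bs + weingarten s g d (-r) m beus beu + d * weingartenVariation s g bs be us gu)
    (hR : alv - beu = curlTerm g s d r al as be bs)
    (hRs : alvs - beus = curlTermConj g s d r al as be bs) :
    w = (weingarten g s d r m (d * weingartenVariation g s be bs gu us)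
          (d * weingartenVariation s g bs be us gu)
        - weingarten g s d (-r) m (d * weingartenVariation g s al as gv vs)
          (d * weingartenVariation s g as al vs gv)
        - weingarten g s d (-r) m
          (weingarten g s d r m (curlTerm g s d r al as be bs) (curlTermConj g s d r al as be bs))
          (weingarten s g d r m (curlTermConj g s d r al as be bs) (curlTerm g s d r al as be bs)))
        / (-2 * I * r)
      + weingarten g s d r m (-be) (-bs) / (-2 * I * r) * ru
      - weingarten g s d (-r) m al as / (-2 * I * r) * rv := by
  generalize curlTerm g s d r al as be bs = R at *
  generalize curlTermConj g s d r al as be bs = Rs at *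
  have e1 : alv = beu + R := by rw [← hR]; ring
  have e2 : alvs = beus + Rs := by rw [← hRs]; ring
  subst e1 e2
  have h12' : rv * al + weingarten g s d r m (beu + R) (beus + Rs)
    + d * weingartenVariation g s al as gv vs
      = -ru * be + weingarten g s d (-r) m beu beus + d * weingartenVariation g s be bs gu us :=
    mul_left_cancel₀ I_ne_zero (h1.symm.trans h2)
  generalize weingartenVariation g s al as gv vs = T1 at *
  generalize weingartenVariation g s be bs gu us = T2 at *
  generalize weingartenVariation s g as al vs gv = T3 at *
  generalize weingartenVariation s g bs be us gu = T4 at *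
  simp only [weingarten, mul_comm s g] at *
  -- `weingarten` at `r` and at `-r` differ by 2r times the identity, so equating the two
  -- expressions isolates `beu`. The resulting `w` is what one gets by applying the commuting
  -- operators W_{-r} and W_r to the first and second expression and subtracting: al_v and be_u then
  -- enter only through W_{-r} W_r (al_v - be_u).
  have hbeu : beu = (-ru * be + d * T2 - rv * al - d * T1
    - ((r - m) * R + 2 * d * g / (1 + g * s) ^ 2 * (R * s + g * Rs))) / (2 * r) := by
    field_simp
    linear_combination h12'
  have hbeus : beus = (-ru * bs + d * T4 - rv * as - d * T3
    - ((r - m) * Rs + 2 * d * s / (1 + g * s) ^ 2 * (Rs * g + s * R))) / (2 * r) := by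
    rw [eq_div_iff (by simpa using hr)]
    linear_combination h12
  rw [h2, hbeu, hbeus]
  have := I_ne_zero
  have hI : (-2 * I * r)⁻¹ = I * (2 * r)⁻¹ := by
    field_simp
    simp
  rw [div_eq_mul_inv _ (-2 * I * r), div_eq_mul_inv _ (-2 * I * r), div_eq_mul_inv _ (-2 * I * r),
    hI]
  field_simp
  ring

/-- The images `g` and `al` of a point `n` of the unit sphere and of a tangent vector `a` at `n`
under the stereographic projection and its differential. -/
lemma stereographic_relations {n a : Fin 3 → ℝ} {g al : ℂ} (hn : n 0 ^ 2 + n 1 ^ 2 + n 2 ^ 2 = 1)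
    (han : a 0 * n 0 + a 1 * n 1 + a 2 * n 2 = 0) (h2 : n 2 ≠ 1)
    (hg : g = (n 0 + I * n 1) / (1 - n 2)) (hal : al = (a 0 + I * a 1 + g * a 2) / (1 - n 2)) :
    (1 - n 2) * (1 + g * conj g) = 2 ∧
    a 2 * (1 + g * conj g) ^ 2 = 2 * (al * conj g + g * conj al) ∧
    g * (1 - n 2) = n 0 + I * n 1 ∧ al * (1 - n 2) = a 0 + I * a 1 + g * a 2 := by
  have hne : (1 - n 2 : ℂ) ≠ 0 := by
    rw [sub_ne_zero]; exact_mod_cast h2.symm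
  have hnC : (n 0 : ℂ) ^ 2 + n 1 ^ 2 + n 2 ^ 2 = 1 := by exact_mod_cast hn
  have hanC : (a 0 : ℂ) * n 0 + a 1 * n 1 + a 2 * n 2 = 0 := by exact_mod_cast han
  have k1 : g * (1 - n 2) = n 0 + I * n 1 := by rw [hg]; field_simp
  have k2 : al * (1 - n 2) = a 0 + I * a 1 + g * a 2 := by rw [hal]; field_simp
  have k1' : conj g * (1 - n 2) = n 0 - I * n 1 := by
    simpa [sub_eq_add_neg] using congrArg conj k1
  have k2' : conj al * (1 - n 2) = a 0 - I * a 1 + conj g * a 2 := by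
    simpa [sub_eq_add_neg] using congrArg conj k2
  have hB : (1 - n 2) * (1 + g * conj g) = 2 := by
    apply mul_left_cancel₀ hne
    linear_combination (conj g * (1 - n 2)) * k1 + (n 0 + I * n 1) * k1' + hnC - (n 1) ^ 2 * I_sq
  refine ⟨hB, ?_, k1, k2⟩
  -- The second relation is the differential of n₃ = 1 - 2/(1 + |g|²); clearing (1 - n₃)² turns it
  -- into a polynomial consequence of the others.
  apply mul_left_cancel₀ (pow_ne_zero 2 hne)
  linear_combination 2 * a 2 * g * k1' + 2 * a 2 * conj g * k1 - 4 * a 2 * hB - 4 * hanC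
    + 4 * a 1 * n 1 * I_sq + a 2 * ((1 - n 2) * (1 + g * conj g) + 2) * hB
    - 2 * (k2 * (conj g * (1 - n 2)) + (a 0 + I * a 1 + g * a 2) * k1'
    + k1 * (conj al * (1 - n 2)) + k2' * (n 0 + I * n 1))

/-- The derivative of the stereographic coordinate in a direction in which the derivative of the
point is `((r - μ) a) × n`. -/
lemma stereographic_deriv {n a nu : Fin 3 → ℝ} {g al gu : ℂ} {r m m3 : ℝ}
    (hn : n 0 ^ 2 + n 1 ^ 2 + n 2 ^ 2 = 1)
    (han : a 0 * n 0 + a 1 * n 1 + a 2 * n 2 = 0) (h2 : n 2 ≠ 1)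
    (hg : g = (n 0 + I * n 1) / (1 - n 2)) (hal : al = (a 0 + I * a 1 + g * a 2) / (1 - n 2))
    (h0 : nu 0 = (r - m) * a 1 * n 2 - (r - m3) * a 2 * n 1)
    (h1 : nu 1 = (r - m3) * a 2 * n 0 - (r - m) * a 0 * n 2)
    (h3 : nu 2 = (r - m) * (a 0 * n 1 - a 1 * n 0))
    (hgu : gu * (1 - n 2) - g * nu 2 = nu 0 + I * nu 1) :
    gu = I * ((r - m) * al + (m - m3) * (a 2 * g)) := by
  obtain ⟨hB, -, k1, k2⟩ := stereographic_relations hn han h2 hg hal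
  have hne : (1 - n 2 : ℂ) ≠ 0 := by
    rw [sub_ne_zero]; exact_mod_cast h2.symm
  have hanC : (a 0 : ℂ) * n 0 + a 1 * n 1 + a 2 * n 2 = 0 := by exact_mod_cast han
  have k1' : conj g * (1 - n 2) = n 0 - I * n 1 := by
    simpa [sub_eq_add_neg] using congrArg conj k1
  have h0C : (nu 0 : ℂ) = (r - m) * a 1 * n 2 - (r - m3) * a 2 * n 1 := by rw [h0]; push_cast; ring
  have h1C : (nu 1 : ℂ) = (r - m3) * a 2 * n 0 - (r - m) * a 0 * n 2 := by rw [h1]; push_cast; ring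
  have h3C : (nu 2 : ℂ) = (r - m) * (a 0 * n 1 - a 1 * n 0) := by rw [h3]; push_cast; ring
  rw [h0C, h1C, h3C] at hgu
  -- The product (a₁ + i a₂)(n₁ - i n₂) has real part a₁n₁ + a₂n₂, which is -a₃n₃ by orthogonality;
  -- only its imaginary part remains.
  have hX : (a 0 * n 1 - a 1 * n 0 : ℂ) = I * ((a 0 + I * a 1) * (n 0 - I * n 1) + a 2 * n 2) := by
    linear_combination (-I) * hanC + (- (a 1) * n 0 + a 0 * n 1 + I * a 1 * n 1) * I_sq
  rw [hX] at hgu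
  apply mul_right_cancel₀ hne
  linear_combination hgu - I * (r - m) * k2 - I * (m - m3) * a 2 * k1
    + (r - m) * I * (a 0 + I * a 1) * (hB - g * k1') + I * a 2 * (m - r) * k1
    + (a 2 * n 1 * (m3 - r) + n 2 * a 1 * (r - m)) * I_sq

/-- The equation `a_v - b_u = c (a × b)` in the stereographic coordinate. -/
lemma curl_stereographic
    {g s al as be bs gu us gv vs alv beu n2 n2u n2v a2 b2 a01 b01 a01s b01s a01v b01u a2v b2u : ℂ}
    {r d m : ℂ} (hB : 1 + g * s ≠ 0) (hn2 : (1 - n2) * (1 + g * s) = 2)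
    (ha2 : a2 * (1 + g * s) ^ 2 = 2 * (al * s + g * as))
    (hb2 : b2 * (1 + g * s) ^ 2 = 2 * (be * s + g * bs))
    (ha : al * (1 - n2) = a01 + g * a2) (hb : be * (1 - n2) = b01 + g * b2)
    (has : as * (1 - n2) = a01s + s * a2) (hbs : bs * (1 - n2) = b01s + s * b2)
    (hav : alv * (1 - n2) - al * n2v = a01v + (g * a2v + gv * a2))
    (hbu : beu * (1 - n2) - be * n2u = b01u + (g * b2u + gu * b2))
    (hnv : (1 - n2) * (g * vs + gv * s) = n2v * (1 + g * s))
    (hnu : (1 - n2) * (g * us + gu * s) = n2u * (1 + g * s))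
    (h01 : a01v - b01u = (2 * m - d) * (-I) * (a01 * b2 - a2 * b01))
    (h2 : a2v - b2u = m * (-I) * (a01s * b01 - a01 * b01s))
    (hgu : gu = I * weingarten g s d r m al as) (hus : us = -I * weingarten s g d r m as al)
    (hgv : gv = I * weingarten g s d (-r) m be bs) (hvs : vs = -I * weingarten s g d (-r) m bs be) :
    alv - beu = curlTerm g s d r al as be bs := by
  have e2 : n2 = 1 - 2 / (1 + g * s) := by rw [← hn2]; field_simp; ring
  have ea2 : a2 = 2 * (al * s + g * as) / (1 + g * s) ^ 2 := by rw [← ha2]; field_simp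
  have eb2 : b2 = 2 * (be * s + g * bs) / (1 + g * s) ^ 2 := by rw [← hb2]; field_simp
  have ea : a01 = al * (2 / (1 + g * s)) - g * a2 := by
    rw [← hn2]; field_simp; linear_combination - ha
  have eb : b01 = be * (2 / (1 + g * s)) - g * b2 := by
    rw [← hn2]; field_simp; linear_combination - hb
  have eas : a01s = as * (2 / (1 + g * s)) - s * a2 := by
    rw [← hn2]; field_simp; linear_combination - has
  have ebs : b01s = bs * (2 / (1 + g * s)) - s * b2 := by
    rw [← hn2]; field_simp; linear_combination - hbs
  have ev : n2v = 2 / (1 + g * s) ^ 2 * (g * vs + gv * s) := by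
    rw [← hn2]; field_simp; linear_combination - hnv
  have eu : n2u = 2 / (1 + g * s) ^ 2 * (g * us + gu * s) := by
    rw [← hn2]; field_simp; linear_combination - hnu
  -- The first two components of c (a × b) combine into one complex equation because c₁ = c₂ = 2m -
  -- d. Adding g times the third gives the differentiated numerator of `al` minus that of `be`.
  have key : (alv - beu) * (2 / (1 + g * s)) = al * n2v - be * n2u
      + (2 * m - d) * (-I) * (a01 * b2 - a2 * b01) + gv * a2 - gu * b2
      + g * (m * (-I) * (a01s * b01 - a01 * b01s)) := by
    have : 2 / (1 + g * s) = 1 - n2 := by rw [e2]; ring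
    rw [this]
    linear_combination hav - hbu + h01 + g * h2
  rw [ev, eu, ea, eb, eas, ebs, ea2, eb2, hgu, hgv, hus, hvs] at key
  apply mul_right_cancel₀ (b := 2 / (1 + g * s)) (div_ne_zero two_ne_zero hB)
  rw [key]
  simp only [weingarten, curlTerm, mul_comm s g]
  field_simp
  ring

/-- The coefficients of the derivatives of `ρ` in the formula for `g_uv`. -/
lemma weingarten_div_eq (g s be bs r m d W B t x G5 G6 : ℂ) (hB' : B = 1 + t) (ht : t = g * s)
    (hB : B ≠ 0) (hr : r ≠ 0)
    (h1 : r + m ≠ 0) (hW : W = m * B ^ 2 - 4 * d * t) (h2 : B ^ 2 * r + W ≠ 0) (hx : x = -r ^ 2)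
    (hG5 : G5 = (B ^ 2 * x + m * W) / (4 * x * (I * r + I * m) * (B ^ 2 * (I * r) + I * W)))
    (hG6 : G6 = -(I * g ^ 2 * d) / (I * r * (I * r + I * m) * (B ^ 2 * (I * r) + I * W))) :
    weingarten g s d r m (-be) (-bs) / (-2 * I * r) =
      -2 * r * (G5 * (I * weingarten g s d (-r) m be bs)
        + G6 * (-I * weingarten s g d (-r) m bs be)) := by
  have e1 : B ^ 2 * (I * r) + I * W = I * (B ^ 2 * r + W) := by ring
  subst hG5 hG6 hx
  rw [e1, ← mul_add]
  -- Up to the factor B², (r + m) V is the determinant of `weingarten` at `-r`; V stays a letter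
  -- until the denominators are cleared.
  generalize hV : B ^ 2 * r + W = V at *
  simp only [weingarten]
  rw [mul_comm s g, ← ht, ← hB']
  have := I_ne_zero
  field_simp
  subst hV hW hB' ht
  ring

set_option maxHeartbeats 4000000 in
/-- The part of the formula for `g_uv` which is bilinear in the first derivatives of `g`. -/
lemma quadratic_part_eq (g s al as be bs r m n d B D gu us gv vs Rf Rs Q t x : ℂ) (G1 G2 G3 G4 : ℂ)
    (hB' : B = 1 + t) (ht : t = g * s) (hB : B ≠ 0) (hr : r ≠ 0)
    (hQ : Q = m * B ^ 2 - 4 * d * t) (hn : n = m - d)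
    (hx : x = -r ^ 2) (hD : D = (x + m ^ 2) * (B ^ 4 * x + Q ^ 2)) (h2 : D ≠ 0)
    (hgu : gu = I * weingarten g s d r m al as) (hus : us = -I * weingarten s g d r m as al)
    (hgv : gv = I * weingarten g s d (-r) m be bs) (hvs : vs = -I * weingarten s g d (-r) m bs be)
    (hRf : Rf = curlTerm g s d r al as be bs)
    (hRs : Rs = curlTermConj g s d r al as be bs)
    (hG1 : G1 = 2 * s * (B ^ 6 * x ^ 2
      + 2 * B ^ 2 * x * ((4 * t + 2 * t ^ 2 + t ^ 3 + t ^ 4) * m ^ 2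
        + (1 - 5 * t + t ^ 2 + 3 * t ^ 3) * m * n + (5 * t + 3 * t ^ 2) * n ^ 2)
      + 16 * t ^ 2 * (B - 2) * m * n ^ 3
      - m * ((1 + 6 * t - t ^ 2 * (13 - 10 * t + 3 * t ^ 2 + t ^ 4)) * m ^ 3
        - 2 * (B - 2) * (-1 - 6 * t + 18 * t ^ 2 + 2 * t ^ 3 + 3 * t ^ 4) * m ^ 2 * n
        - (2 * t + 66 * t ^ 2 - 18 * t ^ 3 + 14 * t ^ 4) * m * n ^ 2)) / (B ^ 3 * D))
    (hG2 : G2 = 2 * I * g * (B - 2) * -d * (2 * B ^ 4 * x ^ 2 + B ^ 4 * x * m ^ 2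
      + B ^ 2 * r * (x + m ^ 2) * (m + 2 * n * t + m * t ^ 2) - m ^ 2 * Q ^ 2)
      / (B ^ 3 * (I * r) * D))
    (hG3 : G3 = 2 * I * g * (B - 2) * d * (2 * B ^ 4 * x ^ 2 + B ^ 4 * x * m ^ 2
      - B ^ 2 * r * (x + m ^ 2) * (m + 2 * n * t + m * t ^ 2) - m ^ 2 * Q ^ 2)
      / (B ^ 3 * (I * r) * D))
    (hG4 : G4 = -(4 * g ^ 3 * (B - 2) * d ^ 2
      * (-3 * B ^ 2 * x + (m ^ 2 + (8 * m * n - 6 * m ^ 2) * t + m ^ 2 * t ^ 2))) / (B ^ 3 * D)) :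
    (weingarten g s d r m (d * weingartenVariation g s be bs gu us)
      (d * weingartenVariation s g bs be us gu)
      - weingarten g s d (-r) m (d * weingartenVariation g s al as gv vs)
        (d * weingartenVariation s g as al vs gv)
      - weingarten g s d (-r) m (weingarten g s d r m Rf Rs) (weingarten s g d r m Rs Rf)) /
        (-2 * I * r)
    = G1 * gu * gv + G2 * gu * vs + G3 * us * gv + G4 * us * vs := by
  subst hRf hRs hgu hus hgv hvs hG1 hG2 hG3 hG4
  simp only [weingarten, weingartenVariation, curlTerm, curlTermConj]
  rw [mul_comm s g, ← ht, ← hB']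
  have := I_ne_zero
  field_simp
  simp only [I_sq]
  -- D, Q, x, B and t are expanded only now, after `field_simp` has cleared the denominators with D
  -- as a single nonzero letter.
  subst hD hQ hn hx hB' ht
  ring

end

/-! ### The algebraic identity -/

section

open Complex ComplexConjugate

/-- Positivity of `r` fixes the branch of the root, hence the signs of the terms of the Gᵢ that are
odd in it. -/
lemma rt_neg_sq {r : ℝ} (hr : 0 < r) : rt (-r ^ 2) = I * r := by
  have h : Real.sqrt (-r ^ 2) = 0 := Real.sqrt_eq_zero_of_nonpos (by nlinarith)
  simp [rt, h, Real.sqrt_sq hr.le]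

/-- The formula for `w = g_uv`, as an algebraic consequence of the structure equations. -/
lemma mixedDeriv_eq {g gu gv w : ℂ} {al be alv beu : ℂ} {r ru rv m m3 : ℝ} (hr : 0 < r)
    (hD : ((m : ℂ) ^ 2 - r ^ 2) *
      (((m : ℂ) * (1 + g * conj g) ^ 2 - 4 * (m - m3) * (g * conj g)) ^ 2
        - (1 + g * conj g) ^ 4 * r ^ 2) ≠ 0)
    (h1 : w = I * (rv * al + weingarten g (conj g) (m - m3) r m alv (conj alv)
      + (m - m3) * weingartenVariation g (conj g) al (conj al) gv (conj gv)))
    (h2 : w = I * (-ru * be + weingarten g (conj g) (m - m3) (-r) m beu (conj beu)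
      + (m - m3) * weingartenVariation g (conj g) be (conj be) gu (conj gu)))
    (hR : alv - beu = curlTerm g (conj g) (m - m3) r al (conj al) be (conj be))
    (hgu : gu = I * weingarten g (conj g) (m - m3) r m al (conj al))
    (hgv : gv = I * weingarten g (conj g) (m - m3) (-r) m be (conj be)) :
    w = G₁ m m3 g (-r ^ 2) * gu * gv
      + G₂ m m3 g (-r ^ 2) * gu * conj gv
      + G₃ m m3 g (-r ^ 2) * conj gu * gv
      + G₄ m m3 g (-r ^ 2) * conj gu * conj gv
      + G₅ m m3 g (-r ^ 2) * (-2 * r * ru : ℝ) * gv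
      + G₆ m m3 g (-r ^ 2) * (-2 * r * ru : ℝ) * conj gv
      + G₇ m m3 g (-r ^ 2) * (-2 * r * rv : ℝ) * gu
      + G₈ m m3 g (-r ^ 2) * (-2 * r * rv : ℝ) * conj gu := by
  have hrC : (r : ℂ) ≠ 0 := by exact_mod_cast hr.ne'
  have hB : 1 + g * conj g ≠ 0 := by
    rw [mul_conj]
    have : 0 < 1 + normSq g := by linarith [normSq_nonneg g]
    exact_mod_cast this.ne'
  have hus : conj gu = -I * weingarten (conj g) g (m - m3) r m (conj al) al := by
    rw [hgu]; simp [weingarten, map_ofNat]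
  have hvs : conj gv = -I * weingarten (conj g) g (m - m3) (-r) m (conj be) be := by
    rw [hgv]; simp [weingarten, map_ofNat]
  have h12 := mul_left_cancel₀ I_ne_zero (h1.symm.trans h2)
  -- The elimination treats `beu` and its conjugate as separate unknowns, so the conjugate equation
  -- is supplied as well.
  have h12s := congrArg conj h12
  simp only [weingarten, weingartenVariation, map_sub, map_add, map_mul, map_div₀, map_pow,
    map_neg, map_one, map_ofNat, conj_conj, conj_ofReal] at h12s
  have hRs : conj alv - conj beu
      = curlTermConj g (conj g) (m - m3) r al (conj al) be (conj be) := by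
    rw [← map_sub, hR]
    simp only [curlTerm, curlTermConj, map_sub, map_add, map_mul, map_div₀, map_pow,
      map_neg, map_one, map_ofNat, conj_conj, conj_I, conj_ofReal, mul_comm (conj g)]
    ring
  have E := mixedDeriv_of_two_expressions hrC h1 h2
    (by simpa only [weingarten, weingartenVariation] using h12s) hR hRs
  have hrt := rt_neg_sq hr
  have hBg : B g = 1 + g * conj g := by rw [B, mul_conj]
  have hII (z z' z'' : ℂ) : I * z * (I * r) * z' * z'' = -(z * r * z' * z'') := by
    linear_combination (z * r * z' * z'') * I_sq
  have hQg : Q m m3 g = m * B g ^ 2 - 4 * (m - m3) * (g * conj g) := by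
    simp only [Q, P, B, mul_conj]; push_cast; ring
  have hD' : ((-r ^ 2 : ℝ) + (m : ℂ) ^ 2) * (B g ^ 4 * (-r ^ 2 : ℝ) + Q m m3 g ^ 2) ≠ 0 := by
    rw [hQg, hBg]; convert hD using 1; push_cast; ring
  have Q3 := quadratic_part_eq g (conj g) al (conj al) be (conj be) r m m3 (m - m3)
    (B g) _ gu (conj gu) gv (conj gv) _ _ (Q m m3 g) (g * conj g) (-r ^ 2 : ℝ)
    (G₁ m m3 g (-r ^ 2)) (G₂ m m3 g (-r ^ 2)) (G₃ m m3 g (-r ^ 2)) (G₄ m m3 g (-r ^ 2))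
    hBg rfl (hBg ▸ hB) hrC hQg (by ring)
    (by push_cast; ring) rfl hD' hgu hus hgv hvs rfl rfl
    -- The long factor in the denominator of `G₁` is (x + μ₁²)(B⁴x + Q²) multiplied out.
    (by simp only [G₁, P, star_def, ← mul_conj]; congr 1; · push_cast; ring
        rw [hQg, hBg]; push_cast; ring)
    (by simp only [G₂, P, ← mul_conj, hrt, hII]; congr 1 <;> · push_cast; ring)
    (by simp only [G₃, P, ← mul_conj, hrt, hII]; congr 1 <;> · push_cast; ring)
    (by simp only [G₄, P, ← mul_conj]; congr 1 <;> · push_cast; ring)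
  rw [Q3] at E
  obtain ⟨hD1, hD2⟩ := mul_ne_zero_iff.1 hD'
  have hD1' : ((r : ℂ) + m) * (-r + m) ≠ 0 := by convert hD1 using 1; push_cast; ring
  have hD2' : (B g ^ 2 * r + Q m m3 g) * (B g ^ 2 * -r + Q m m3 g) ≠ 0 := by
    convert hD2 using 1; push_cast; ring
  obtain ⟨hp1, hp2⟩ := mul_ne_zero_iff.1 hD1'
  obtain ⟨hq1, hq2⟩ := mul_ne_zero_iff.1 hD2'
  have T1 := weingarten_div_eq g (conj g) be (conj be) r m (m - m3) (Q m m3 g) (B g) (g * conj g)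
    (-r ^ 2 : ℝ) (G₅ m m3 g (-r ^ 2)) (G₆ m m3 g (-r ^ 2)) hBg rfl (hBg ▸ hB) hrC hp1 hQg hq1
    (by push_cast; ring) (by rw [G₅, hrt]) (by rw [G₆, hrt])
  -- Exchanging u and v replaces ρ by -ρ, so `G₇`, `G₈` come from the identity for `G₅`, `G₆` at
  -- `-r`.
  have T2 := weingarten_div_eq g (conj g) al (conj al) (-r) m (m - m3) (Q m m3 g) (B g) (g * conj g)
    (-r ^ 2 : ℝ) (G₇ m m3 g (-r ^ 2)) (G₈ m m3 g (-r ^ 2)) hBg rfl (hBg ▸ hB)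
    (neg_ne_zero.2 hrC) hp2 hQg hq2 (by push_cast; ring) (by rw [G₇, hrt]; congr 1; ring)
    (by rw [G₈, hrt, ← neg_div_neg_eq]; congr 1; ring)
  rw [← hgv, ← hvs] at T1
  rw [neg_neg, ← hgu, ← hus] at T2
  have T2' : weingarten g (conj g) (m - m3) (-r) m al (conj al) / (-2 * I * r)
      = weingarten g (conj g) (m - m3) (-r) m (-al) (-conj al) / (-2 * I * -r) := by
    simp only [weingarten]; ring
  rw [T1, T2', T2] at E
  rw [E]
  push_cast
  ring

end

/-! ### The equation in the coordinates -/

section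

open Complex ComplexConjugate

open Matrix in
/-- The second order equation for the stereographic coordinate `g` of a map `n` into the unit
sphere which satisfies `n_u = ((ρ - μ) a) × n`, `n_v = ((-ρ - μ) b) × n` for tangent fields `a`, `b`
with `a_v - b_u = c (a × b)`. -/
lemma pd_pd_gaussMap_eq {U : Set (EuclideanSpace ℝ (Fin 2))} (hU : IsOpen U)
    {x : EuclideanSpace ℝ (Fin 2)} (hx : x ∈ U)
    {n a b : EuclideanSpace ℝ (Fin 2) → Fin 3 → ℝ} {ρ : EuclideanSpace ℝ (Fin 2) → ℝ} {m m3 : ℝ}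
    {g : EuclideanSpace ℝ (Fin 2) → ℂ}
    (hn : ContDiffOn ℝ 2 n U) (ha : DifferentiableAt ℝ a x) (hb : DifferentiableAt ℝ b x)
    (hρ : DifferentiableAt ℝ ρ x) (hρx : 0 < ρ x)
    (hg : ∀ y ∈ U, g y = (n y 0 + I * n y 1) / (1 - n y 2)) (hne : ∀ y ∈ U, n y 2 ≠ 1)
    (hnn : ∀ y ∈ U, n y ⬝ᵥ n y = 1) (han : ∀ y ∈ U, a y ⬝ᵥ n y = 0)
    (hbn : ∀ y ∈ U, b y ⬝ᵥ n y = 0)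
    (hnu : ∀ y ∈ U, pd 0 n y = crossProduct (fun k => (ρ y - ![m, m, m3] k) * a y k) (n y))
    (hnv : ∀ y ∈ U, pd 1 n y = crossProduct (fun k => (-ρ y - ![m, m, m3] k) * b y k) (n y))
    (hab : pd 1 a x - pd 0 b x = fun k => ![m + m3, m + m3, 2 * m] k * crossProduct (a x) (b x) k)
    (hD : ((m : ℂ) ^ 2 - ρ x ^ 2) *
      (((m : ℂ) * (1 + g x * conj (g x)) ^ 2 - 4 * (m - m3) * (g x * conj (g x))) ^ 2
        - (1 + g x * conj (g x)) ^ 4 * ρ x ^ 2) ≠ 0) :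
    pd 1 (pd 0 g) x = G₁ m m3 (g x) (-ρ x ^ 2) * pd 0 g x * pd 1 g x
      + G₂ m m3 (g x) (-ρ x ^ 2) * pd 0 g x * conj (pd 1 g x)
      + G₃ m m3 (g x) (-ρ x ^ 2) * conj (pd 0 g x) * pd 1 g x
      + G₄ m m3 (g x) (-ρ x ^ 2) * conj (pd 0 g x) * conj (pd 1 g x)
      + G₅ m m3 (g x) (-ρ x ^ 2) * (-2 * ρ x * pd 0 ρ x : ℝ) * pd 1 g x
      + G₆ m m3 (g x) (-ρ x ^ 2) * (-2 * ρ x * pd 0 ρ x : ℝ) * conj (pd 1 g x)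
      + G₇ m m3 (g x) (-ρ x ^ 2) * (-2 * ρ x * pd 1 ρ x : ℝ) * pd 0 g x
      + G₈ m m3 (g x) (-ρ x ^ 2) * (-2 * ρ x * pd 1 ρ x : ℝ) * conj (pd 0 g x) := by
  have hnear : ∀ᶠ y in nhds x, y ∈ U := hU.mem_nhds hx
  have hnC (k : Fin 3) : ContDiffOn ℝ 2 (fun y => (n y k : ℂ)) U :=
    ofRealCLM.contDiff.comp_contDiffOn ((contDiff_apply ℝ ℝ k).comp_contDiffOn hn)
  have hne' : ∀ y ∈ U, (1 - n y 2 : ℂ) ≠ 0 := fun y hy => by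
    rw [sub_ne_zero]; exact_mod_cast (hne y hy).symm
  have hgC : ContDiffOn ℝ 2 g U := by
    refine ContDiffOn.congr ?_ (fun y hy => (hg y hy).trans (div_eq_mul_inv _ _))
    exact ((hnC 0).add (contDiffOn_const.mul (hnC 1))).mul
      ((contDiffOn_const.sub (hnC 2)).inv hne')
  have hgx : ∀ y ∈ U, ContDiffAt ℝ 2 g y := fun y hy => hgC.contDiffAt (hU.mem_nhds hy)
  have hgd : ∀ y ∈ U, DifferentiableAt ℝ g y := fun y hy =>
    (hgx y hy).differentiableAt (by norm_num)
  have hnd : ∀ y ∈ U, DifferentiableAt ℝ n y := fun y hy =>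
    (hn.contDiffAt (hU.mem_nhds hy)).differentiableAt (by norm_num)
  have hnd' : ∀ y ∈ U, ∀ k, DifferentiableAt ℝ (fun y => n y k) y := fun y hy k =>
    (differentiableAt_pi.1 (hnd y hy)) k
  have hndC : ∀ y ∈ U, ∀ k, DifferentiableAt ℝ (fun y => (n y k : ℂ)) y := fun y hy k =>
    ((hnC k).contDiffAt (hU.mem_nhds hy)).differentiableAt (by norm_num)
  have pdn : ∀ i, ∀ y ∈ U, ∀ k, pd i (fun y => (n y k : ℂ)) y = pd i n y k := fun i y hy k => by
    rw [pd_ofReal (hnd' y hy k), pd_apply (hnd y hy)]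
  have hgn (i : Fin 2) : ∀ y ∈ U, pd i g y * (1 - n y 2) - g y * (pd i n y 2 : ℝ)
      = (pd i n y 0 : ℝ) + I * (pd i n y 1 : ℝ) := by
    intro y hy
    have e : (fun y => g y * (1 - n y 2)) =ᶠ[nhds y] fun y => n y 0 + I * n y 1 := by
      filter_upwards [hU.mem_nhds hy] with z hz
      rw [hg z hz, div_mul_cancel₀ _ (hne' z hz)]
    have := pd_congr (i := i) e
    rw [pd_mul (hgd y hy) ((differentiableAt_const _).fun_sub (hndC y hy 2)),
      pd_sub (differentiableAt_const _) (hndC y hy 2), pd_const,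
      pd_add (hndC y hy 0) ((differentiableAt_const _).fun_mul (hndC y hy 1)),
      pd_mul (differentiableAt_const _) (hndC y hy 1), pd_const, pdn i y hy, pdn i y hy,
      pdn i y hy] at this
    rw [← sub_eq_zero] at this ⊢
    rw [← this]; ring
  have hcd (f : EuclideanSpace ℝ (Fin 2) → ℂ) (hf : DifferentiableAt ℝ f x) :
      DifferentiableAt ℝ (fun y => conj (f y)) x := conjCLE.differentiableAt.comp x hf
  have P0 : ∀ y ∈ U, n y 0 ^ 2 + n y 1 ^ 2 + n y 2 ^ 2 = 1 := fun y hy => by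
    rw [← hnn y hy, dotProduct_fin_three]; ring
  have hB2 : ∀ y ∈ U, (1 - n y 2 : ℂ) * (1 + g y * conj (g y)) = 2 := fun y hy =>
    (stereographic_relations (P0 y hy) ((dotProduct_fin_three _ _).symm.trans (han y hy))
      (hne y hy) (hg y hy) rfl).1
  have hB : 1 + g x * conj (g x) ≠ 0 := fun h => by
    have := hB2 x hx
    simp [h] at this
  have hBd : DifferentiableAt ℝ (fun y => 1 + g y * conj (g y)) x :=
    (differentiableAt_const _).fun_add ((hgd x hx).fun_mul (hcd g (hgd x hx)))
  have pdB (j : Fin 2) : pd j (fun y => 1 + g y * conj (g y)) x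
      = g x * conj (pd j g x) + pd j g x * conj (g x) := by
    rw [pd_add (differentiableAt_const _) ((hgd x hx).fun_mul (hcd g (hgd x hx))), pd_const,
      pd_mul (hgd x hx) (hcd g (hgd x hx)), pd_conj (hgd x hx), zero_add]
  have hn2 (j : Fin 2) : (1 - n x 2 : ℂ) * (g x * conj (pd j g x) + pd j g x * conj (g x))
      = (pd j n x 2 : ℝ) * (1 + g x * conj (g x)) := by
    have e : (fun y => (1 - n y 2 : ℂ) * (1 + g y * conj (g y))) =ᶠ[nhds x] fun _ => 2 := by
      filter_upwards [hnear] with z hz using hB2 z hz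
    have := pd_congr (i := j) e
    rw [pd_mul ((differentiableAt_const _).fun_sub (hndC x hx 2)) hBd, pdB, pd_const,
      pd_sub (differentiableAt_const _) (hndC x hx 2), pd_const, pdn j x hx] at this
    linear_combination this
  -- One argument serves (a, ρ), differentiated in u and then v, and (b, -ρ), differentiated in v
  -- and then u. The witnesses are the image `al` of the tangent vector under the differential of
  -- the projection and its derivative in the direction `j`.
  have step (w : EuclideanSpace ℝ (Fin 2) → Fin 3 → ℝ) (σ : EuclideanSpace ℝ (Fin 2) → ℝ)
      (i j : Fin 2) (hw : DifferentiableAt ℝ w x) (hσ : DifferentiableAt ℝ σ x)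
      (hwn : ∀ y ∈ U, w y ⬝ᵥ n y = 0)
      (hnw : ∀ y ∈ U, pd i n y = crossProduct (fun k => (σ y - ![m, m, m3] k) * w y k) (n y)) :
      ∃ al alv : ℂ,
        w x 2 * (1 + g x * conj (g x)) ^ 2 = 2 * (al * conj (g x) + g x * conj al) ∧
        al * (1 - n x 2) = w x 0 + I * w x 1 + g x * w x 2 ∧
        pd i g x = I * weingarten (g x) (conj (g x)) (m - m3) (σ x) m al (conj al) ∧
        alv * (1 - n x 2) - al * (pd j n x 2 : ℝ) = (pd j w x 0 : ℝ) + I * (pd j w x 1 : ℝ)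
          + (g x * (pd j w x 2 : ℝ) + pd j g x * w x 2) ∧
        pd j (pd i g) x = I * (pd j σ x * al
          + weingarten (g x) (conj (g x)) (m - m3) (σ x) m alv (conj alv)
          + (m - m3) * weingartenVariation (g x) (conj (g x)) al (conj al)
              (pd j g x) (conj (pd j g x))) := by
    have hwC (k : Fin 3) : DifferentiableAt ℝ (fun y => (w y k : ℂ)) x :=
      ofRealCLM.differentiableAt.comp x (differentiableAt_pi.1 hw k)
    have pdw (k : Fin 3) : pd j (fun y => (w y k : ℂ)) x = pd j w x k := by
      rw [pd_ofReal (differentiableAt_pi.1 hw k), pd_apply hw]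
    have hσC : DifferentiableAt ℝ (fun y => (σ y : ℂ)) x := ofRealCLM.differentiableAt.comp x hσ
    obtain ⟨alF, halF⟩ : ∃ alF : EuclideanSpace ℝ (Fin 2) → ℂ,
      alF = fun y => (w y 0 + I * w y 1 + g y * w y 2) / (1 - n y 2) := ⟨_, rfl⟩
    have hal : DifferentiableAt ℝ alF x := by
      rw [halF]
      simp only [div_eq_mul_inv]
      exact (((hwC 0).fun_add ((differentiableAt_const _).fun_mul (hwC 1))).fun_add
        ((hgd x hx).fun_mul (hwC 2))).fun_mul
        (((differentiableAt_const _).fun_sub (hndC x hx 2)).fun_inv (hne' x hx))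
    have P1 := fun y hy => stereographic_relations (P0 y hy)
      ((dotProduct_fin_three _ _).symm.trans (hwn y hy)) (hne y hy) (hg y hy) (congrFun halF y)
    have P2 : ∀ y ∈ U, pd i g y = I * ((σ y - m) * alF y + (m - m3) * (w y 2 * g y)) := by
      intro y hy
      refine stereographic_deriv (P0 y hy) ((dotProduct_fin_three _ _).symm.trans (hwn y hy))
        (hne y hy) (hg y hy) (congrFun halF y) ?_ ?_ ?_ (hgn i y hy)
      all_goals
        rw [hnw y hy]
        simp [cross_apply]
      ring
    have D1 : alF x * (0 - (pd j n x 2 : ℝ)) + pd j alF x * (1 - n x 2)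
        = (pd j w x 0 : ℝ) + (I * (pd j w x 1 : ℝ) + 0 * w x 1)
          + (g x * (pd j w x 2 : ℝ) + pd j g x * w x 2) := by
      have e : (fun y => alF y * (1 - n y 2)) =ᶠ[nhds x]
          fun y => w y 0 + I * w y 1 + g y * w y 2 := by
        filter_upwards [hnear] with z hz using (P1 z hz).2.2.2
      have := pd_congr (i := j) e
      rwa [pd_mul hal ((differentiableAt_const _).fun_sub (hndC x hx 2)),
        pd_sub (differentiableAt_const _) (hndC x hx 2), pd_const,
        pd_add ((hwC 0).fun_add ((differentiableAt_const _).fun_mul (hwC 1)))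
          ((hgd x hx).fun_mul (hwC 2)),
        pd_add (hwC 0) ((differentiableAt_const _).fun_mul (hwC 1)),
        pd_mul (differentiableAt_const _) (hwC 1), pd_mul (hgd x hx) (hwC 2), pd_const, pdn j x hx,
        pdw, pdw, pdw] at this
    have D2 : w x 2 * (2 * (1 + g x * conj (g x)) * (g x * conj (pd j g x) + pd j g x * conj (g x)))
        + (pd j w x 2 : ℝ) * (1 + g x * conj (g x)) ^ 2
        = 2 * (alF x * conj (pd j g x) + pd j alF x * conj (g x)
          + (g x * conj (pd j alF x) + pd j g x * conj (alF x))) := by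
      have e : (fun y => w y 2 * ((1 + g y * conj (g y)) * (1 + g y * conj (g y)))) =ᶠ[nhds x]
          fun y => 2 * (alF y * conj (g y) + g y * conj (alF y)) := by
        filter_upwards [hnear] with z hz
        rw [← (P1 z hz).2.1, sq]
      have := pd_congr (i := j) e
      rw [pd_mul (hwC 2) (hBd.fun_mul hBd), pd_mul hBd hBd, pdB, pdw,
        pd_mul (differentiableAt_const _)
          ((hal.fun_mul (hcd g (hgd x hx))).fun_add ((hgd x hx).fun_mul (hcd _ hal))), pd_const,
        pd_add (hal.fun_mul (hcd g (hgd x hx))) ((hgd x hx).fun_mul (hcd _ hal)),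
        pd_mul hal (hcd g (hgd x hx)), pd_mul (hgd x hx) (hcd _ hal), pd_conj hal,
          pd_conj (hgd x hx)] at this
      linear_combination this
    have D3 : pd j (pd i g) x = I * (pd j σ x * alF x + (σ x - m) * pd j alF x
        + (m - m3) * ((pd j w x 2 : ℝ) * g x + w x 2 * pd j g x)) := by
      have e : pd i g =ᶠ[nhds x] fun y => I * ((σ y - m) * alF y + (m - m3) * (w y 2 * g y)) := by
        filter_upwards [hnear] with z hz using P2 z hz
      have d1 := hσC.fun_sub (differentiableAt_const (m : ℂ))
      have d2 := (hwC 2).fun_mul (hgd x hx)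
      rw [pd_congr e, pd_mul (differentiableAt_const _) ((d1.fun_mul hal).fun_add
        ((differentiableAt_const _).fun_mul d2)), pd_const, pd_add (d1.fun_mul hal)
        ((differentiableAt_const _).fun_mul d2), pd_mul d1 hal,
        pd_mul (differentiableAt_const _) d2, pd_const, pd_mul (hwC 2) (hgd x hx),
        pd_sub hσC (differentiableAt_const _), pd_const,
        pd_ofReal hσ, pdw]
      ring
    have e2 : (w x 2 : ℂ) = 2 * (alF x * conj (g x) + g x * conj (alF x))
        / (1 + g x * conj (g x)) ^ 2 := by
      rw [← (P1 x hx).2.1]; field_simp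
    have e2v : ((pd j w x 2 : ℝ) : ℂ) = (2 * (alF x * conj (pd j g x) + pd j alF x * conj (g x)
          + (g x * conj (pd j alF x) + pd j g x * conj (alF x))) -
          w x 2 * (2 * (1 + g x * conj (g x)) * (g x * conj (pd j g x) + pd j g x * conj (g x)))) /
            (1 + g x * conj (g x)) ^ 2 := by
      rw [← D2]; field_simp; ring
    refine ⟨alF x, pd j alF x, (P1 x hx).2.1, (P1 x hx).2.2.2, ?_, ?_, ?_⟩
    · rw [P2 x hx, weingarten, e2]; ring
    · linear_combination D1
    · rw [D3, e2v, e2, weingarten, weingartenVariation]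
      generalize 1 + g x * conj (g x) = Bx at hB
      field_simp
      ring
  have hρ' : DifferentiableAt ℝ (fun y => -ρ y) x := hρ.fun_neg
  obtain ⟨al, alv, a1, a2, a3, a4, a5⟩ := step a ρ 0 1 ha hρ han hnu
  obtain ⟨be, beu, b1, b2, b3, b4, b5⟩ := step b _ 1 0 hb hρ' hbn hnv
  have hpr : pd 0 (fun y => -ρ y) x = -pd 0 ρ x := by
    simp [pd, fderiv_fun_neg]
  rw [hpr] at b5
  push_cast at b3 b5
  rw [pd_comm (hgx x hx)] at b5
  refine mixedDeriv_eq hρx hD a5 b5 ?_ a3 b3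
  have hab' (k : Fin 3) : ((pd 1 a x k : ℝ) : ℂ) - (pd 0 b x k : ℝ)
      = (![m + m3, m + m3, 2 * m] k * crossProduct (a x) (b x) k : ℝ) := by
    rw [← congrFun hab k]; simp
  have h0 := hab' 0
  have h1 := hab' 1
  have h2 := hab' 2
  simp [cross_apply] at h0 h1 h2
  refine curl_stereographic (a2 := a x 2) (b2 := b x 2) (a01s := a x 0 - I * a x 1)
    (b01s := b x 0 - I * b x 1) (n2v := pd 1 n x 2) (n2u := pd 0 n x 2)
    (a2v := pd 1 a x 2) (b2u := pd 0 b x 2)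
    hB (hB2 x hx) a1 b1 a2 b2 ?_ ?_ a4 b4 (hn2 1) (hn2 0)
    (r := ρ x) (m := m) (d := m - m3) ?_ ?_ a3 ?_ b3 ?_
  · simpa [sub_eq_add_neg] using congrArg conj a2
  · simpa [sub_eq_add_neg] using congrArg conj b2
  · linear_combination h0 + I * h1 + (m + m3) * (a x 1 * b x 2 - a x 2 * b x 1) * I_sq
  · linear_combination h2 + m * (2 * a x 0 * b x 1 - 2 * a x 1 * b x 0) * I_sq
  · rw [a3]; simp [weingarten, map_ofNat]
  · rw [b3]; simp [weingarten, map_ofNat]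

end

/-! ### Components in the left invariant frame -/

section Frame

variable {M : Type*} [TopologicalSpace M] [ChartedSpace (EuclideanSpace ℝ (Fin 3)) M]
  [Group M] [LieGroup (𝓡 3) ∞ M]

/-- The Lie ring structure on `GroupLieAlgebra`, needed for `lie_skew`, asks for this regularity,
which over ℝ is just C³. -/
instance lieGroup_minSmoothness : LieGroup (𝓡 3) (minSmoothness ℝ 3) M :=
  LieGroup.of_le (m := minSmoothness ℝ 3) (n := ∞) (by simpa using ENat.LEInfty.out)

variable {m : Metric M} {E : Fin 3 → GroupLieAlgebra (𝓡 3) M} {c : Fin 3 → ℝ}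

lemma inner_frame (hm : IsLeftInvariant m) (hE : IsUnimodularFrame m E c) (q : M) (i j : Fin 3) :
    m.inner q (mulInvariantVectorField (E i) q) (mulInvariantVectorField (E j) q)
      = if i = j then 1 else 0 := by
  rw [hm, hE.orthonormal]

/-- The expansion of a tangent vector in the left invariant frame. -/
lemma sum_comp_smul (hm : IsLeftInvariant m) (hE : IsUnimodularFrame m E c) (q : M)
    (v : TangentSpace (𝓡 3) q) :
    ∑ i, comp m E q v i • mulInvariantVectorField (E i) q = v := by
  set F : Fin 3 → TangentSpace (𝓡 3) q := fun i => mulInvariantVectorField (E i) q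
  have hij : ∀ i j, m.inner q (F i) (F j) = if i = j then 1 else 0 := inner_frame hm hE q
  have hli : LinearIndependent ℝ F := by
    rw [Fintype.linearIndependent_iff]
    intro t ht j
    have := congrArg (fun w => m.inner q w (F j)) ht
    simpa [hij] using this
  have hspan : Submodule.span ℝ (Set.range F) = ⊤ := by
    have : FiniteDimensional ℝ (TangentSpace (𝓡 3) q) :=
      inferInstanceAs (FiniteDimensional ℝ (EuclideanSpace ℝ (Fin 3)))
    apply hli.span_eq_top_of_card_eq_finrank'
    change Fintype.card (Fin 3) = Module.finrank ℝ (EuclideanSpace ℝ (Fin 3))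
    simp
  have hv : v ∈ Submodule.span ℝ (Set.range F) := hspan ▸ Submodule.mem_top
  obtain ⟨t, rfl⟩ := (Submodule.mem_span_range_iff_exists_fun ℝ).1 hv
  refine Finset.sum_congr rfl fun i _ => ?_
  congr 1
  change m.inner q (∑ j, t j • F j) (F i) = t i
  simp [hij]

lemma inner_eq_dotProduct (hm : IsLeftInvariant m) (hE : IsUnimodularFrame m E c) (q : M)
    (v w : TangentSpace (𝓡 3) q) : m.inner q v w = comp m E q v ⬝ᵥ comp m E q w := by
  conv_lhs => rw [← sum_comp_smul hm hE q w]
  simp [dotProduct, comp, mul_comm]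

/-- In the left invariant frame, `∇_a n - a(n) = (μ a) × n`. -/
lemma christoffel_sum (hE : IsUnimodularFrame m E c) (a n : Fin 3 → ℝ) (k : Fin 3) :
    ∑ i, ∑ j, a i * n j * christoffel m E i j k
      = crossProduct (fun i => mu c i * a i) n k := by
  have h10 : ⁅E 1, E 0⁆ = -(c 2 • E 2) := by rw [← lie_skew, hE.lie_zero_one]
  have h21 : ⁅E 2, E 1⁆ = -(c 0 • E 0) := by rw [← lie_skew, hE.lie_one_two]
  have h02 : ⁅E 0, E 2⁆ = -(c 1 • E 1) := by rw [← lie_skew, hE.lie_two_zero]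
  fin_cases k <;>
  simp [Fin.sum_univ_three, christoffel, h10, h21, h02, hE.lie_one_two, hE.lie_two_zero,
    hE.lie_zero_one, hE.orthonormal, mu, cross_apply] <;> ring

/-- The metric is a smooth section of a bundle of bilinear forms, evaluated here on `v` and on a
smooth invariant field. Order 2 suffices for a second order equation. -/
lemma contMDiffWithinAt_comp {F H X : Type*} [NormedAddCommGroup F] [NormedSpace ℝ F]
    [TopologicalSpace H] {I : ModelWithCorners ℝ F H} [TopologicalSpace X] [ChartedSpace H X]
    {f : X → M} {v : ∀ x, TangentSpace (𝓡 3) (f x)} {s : Set X} {x : X}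
    (hv : ContMDiffWithinAt I (𝓡 3).tangent 2
      (fun x => (⟨f x, v x⟩ : TangentBundle (𝓡 3) M)) s x) (i : Fin 3) :
    ContMDiffWithinAt I 𝓘(ℝ, ℝ) 2 (fun x => comp m E (f x) (v x) i) s x := by
  have hf : ContMDiffWithinAt I (𝓡 3) 2 f s x := (contMDiffWithinAt_totalSpace.1 hv).1
  have hE : ContMDiffWithinAt I (𝓡 3).tangent 2
      (fun x => (⟨f x, mulInvariantVectorField (E i) (f x)⟩ : TangentBundle (𝓡 3) M)) s x := by
    have h := (contMDiff_mulInvariantVectorField (I := 𝓡 3) (G := M) (E i)).of_le (m := 2) (by simp)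
    exact h.contMDiffAt.comp_contMDiffWithinAt x hf
  have hm : ContMDiff (𝓡 3)
      ((𝓡 3).prod 𝓘(ℝ, EuclideanSpace ℝ (Fin 3) →L[ℝ] EuclideanSpace ℝ (Fin 3) →L[ℝ] ℝ)) 2
      (fun q => TotalSpace.mk' (EuclideanSpace ℝ (Fin 3) →L[ℝ] EuclideanSpace ℝ (Fin 3) →L[ℝ] ℝ)
        q (m.inner q)) := m.contMDiff.of_le ENat.LEInfty.out
  have : ContMDiffWithinAt I ((𝓡 3).prod 𝓘(ℝ)) 2
      (fun x => TotalSpace.mk' ℝ (E := Bundle.Trivial M ℝ) (f x)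
        (m.inner (f x) (v x) (mulInvariantVectorField (E i) (f x)))) s x := by
    apply ContMDiffWithinAt.clm_bundle_apply₂ (F₁ := EuclideanSpace ℝ (Fin 3))
      (F₂ := EuclideanSpace ℝ (Fin 3))
    · exact hm.contMDiffAt.comp_contMDiffWithinAt x hf
    · exact hv
    · exact hE
  exact (contMDiffWithinAt_totalSpace.1 this).2

end Frame

/-! ### Regularity of the components of N, φ_u and φ_v in a chart of the surface. -/

section Chart

variable {M : Type*} [TopologicalSpace M] [ChartedSpace (EuclideanSpace ℝ (Fin 3)) M]
  [Group M] [LieGroup (𝓡 3) ∞ M]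
  {S : Type*} [TopologicalSpace S] [ChartedSpace (EuclideanSpace ℝ (Fin 2)) S]
  {m : Metric M} {E : Fin 3 → GroupLieAlgebra (𝓡 3) M} {c : Fin 3 → ℝ} {φ : S → M}
  {N : ∀ p : S, TangentSpace (𝓡 3) (φ p)}

lemma contMDiff_normalComp (hφ : IsImmersionWithNormal m φ N) (k : Fin 3) :
    ContMDiff (𝓡 2) 𝓘(ℝ, ℝ) 2 (fun p => normalComp m E φ N p k) := fun p =>
  contMDiffWithinAt_comp ((hφ.contMDiff_normal p).of_le ENat.LEInfty.out) k

variable {χ : OpenPartialHomeomorph S (EuclideanSpace ℝ (Fin 2))}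

lemma contMDiffOn_chart_symm (hχ : χ ∈ IsManifold.maximalAtlas (𝓡 2) ∞ S) :
    ContMDiffOn 𝓘(ℝ, EuclideanSpace ℝ (Fin 2)) (𝓡 2) ∞ χ.symm χ.target :=
  contMDiffOn_symm_of_mem_maximalAtlas hχ

lemma mdifferentiableAt_chart_symm (hχ : χ ∈ IsManifold.maximalAtlas (𝓡 2) ∞ S)
    {y : EuclideanSpace ℝ (Fin 2)} (hy : y ∈ χ.target) : MDifferentiableAt (𝓡 2) (𝓡 2) χ.symm y :=
  ((contMDiffOn_chart_symm hχ).contMDiffAt (χ.open_target.mem_nhds hy)).mdifferentiableAt (by simp)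

/-- Components of the normal as functions of the coordinates. -/
lemma contDiffOn_normalComp (hφ : IsImmersionWithNormal m φ N)
    (hχ : χ ∈ IsManifold.maximalAtlas (𝓡 2) ∞ S) :
    ContDiffOn ℝ 2 (fun y => normalComp m E φ N (χ.symm y)) χ.target := by
  rw [contDiffOn_pi]
  intro k
  rw [← contMDiffOn_iff_contDiffOn]
  exact (contMDiff_normalComp hφ k).comp_contMDiffOn
    ((contMDiffOn_chart_symm hχ).of_le ENat.LEInfty.out)

lemma mfderiv_comp_coordVec (hφ : IsImmersionWithNormal m φ N)
    (hχ : χ ∈ IsManifold.maximalAtlas (𝓡 2) ∞ S) {y : EuclideanSpace ℝ (Fin 2)} (hy : y ∈ χ.target)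
    (i : Fin 2) : mfderiv (𝓡 2) (𝓡 3) φ (χ.symm y) (coordVec χ y i)
      = mfderiv (𝓡 2) (𝓡 3) (φ ∘ χ.symm) y (e i) := by
  rw [mfderiv_comp y (hφ.contMDiff.mdifferentiableAt (by simp))
    (mdifferentiableAt_chart_symm hχ hy)]
  rfl

lemma mvfderiv_coordVec (hφ : IsImmersionWithNormal m φ N)
    (hχ : χ ∈ IsManifold.maximalAtlas (𝓡 2) ∞ S) {y : EuclideanSpace ℝ (Fin 2)} (hy : y ∈ χ.target)
    (i : Fin 2) (k : Fin 3) :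
    mvfderiv (𝓡 2) (fun p => normalComp m E φ N p k) (χ.symm y) (coordVec χ y i)
      = pd i (fun y => normalComp m E φ N (χ.symm y)) y k := by
  rw [← pd_apply (((contDiffOn_normalComp hφ hχ).contDiffAt
    (χ.open_target.mem_nhds hy)).differentiableAt (by simp))]
  have h := mfderiv_comp (I := 𝓡 2) (I' := 𝓡 2) (I'' := 𝓘(ℝ, ℝ)) y
    (((contMDiff_normalComp (E := E) hφ k) (χ.symm y)).mdifferentiableAt (by simp))
      (mdifferentiableAt_chart_symm hχ hy)
  have h2 := congrArg (fun l => l (e i)) h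
  rw [mfderiv_eq_fderiv] at h2
  exact h2.symm

/-- The field φ_u or φ_v is the tangent map of φ ∘ χ⁻¹ applied to a constant section, hence smooth.
-/
lemma contDiffOn_tangentComp (hφ : IsImmersionWithNormal m φ N)
    (hχ : χ ∈ IsManifold.maximalAtlas (𝓡 2) ∞ S) (i : Fin 2) :
    ContDiffOn ℝ 2 (fun y => tangentComp m E φ (χ.symm y) (coordVec χ y i)) χ.target := by
  rw [contDiffOn_pi]
  intro k
  rw [← contMDiffOn_iff_contDiffOn]
  intro y hy
  have hψ : ContMDiffOn 𝓘(ℝ, EuclideanSpace ℝ (Fin 2)) (𝓡 3) ∞ (φ ∘ χ.symm) χ.target :=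
    hφ.contMDiff.comp_contMDiffOn (contMDiffOn_chart_symm hχ)
  have h1 := hψ.contMDiffOn_tangentMapWithin (m := 2) (n := ∞)
    (by norm_num; exact ENat.LEInfty.out) χ.open_target.uniqueMDiffOn
  have h2 : ContMDiffWithinAt 𝓘(ℝ, EuclideanSpace ℝ (Fin 2))
      (𝓘(ℝ, EuclideanSpace ℝ (Fin 2))).tangent 2
      (fun y => (⟨y, e i⟩ :
        TangentBundle 𝓘(ℝ, EuclideanSpace ℝ (Fin 2)) (EuclideanSpace ℝ (Fin 2)))) χ.target y :=
    contMDiffWithinAt_vectorSpace_iff_contDiffWithinAt.2 contDiffWithinAt_const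
  have h3 : ContMDiffWithinAt 𝓘(ℝ, EuclideanSpace ℝ (Fin 2)) (𝓡 3).tangent 2
      (fun y => (⟨φ (χ.symm y), mfderiv (𝓡 2) (𝓡 3) φ (χ.symm y) (coordVec χ y i)⟩ :
        TangentBundle (𝓡 3) M)) χ.target y := by
    have h4 : ∀ z ∈ χ.target, (⟨φ (χ.symm z), mfderiv (𝓡 2) (𝓡 3) φ (χ.symm z) (coordVec χ z i)⟩ :
        TangentBundle (𝓡 3) M) = tangentMapWithin 𝓘(ℝ, EuclideanSpace ℝ (Fin 2)) (𝓡 3) (φ ∘ χ.symm)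
          χ.target ⟨z, e i⟩ := by
      intro z hz
      rw [mfderiv_comp_coordVec hφ hχ hz, tangentMapWithin,
        mfderivWithin_of_isOpen χ.open_target hz]
      rfl
    have h5 := (h1 ⟨y, e i⟩ (by simpa using hy)).comp y h2 (fun z hz => by simpa using hz)
    exact h5.congr h4 (h4 y hy)
  exact contMDiffWithinAt_comp h3 k

end Chart

/-! ### The Maurer–Cartan equation -/

section

open VectorField

/-- If `f_u = ∑ a_k V_k` and `f_v = ∑ b_k V_k` along `f`, then the symmetry of the second derivative
of `f` reads `∑ (a_v - b_u)_k V_k = ∑ a_k b_l [V_k, V_l]`. -/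
lemma sum_smul_eq_sum_lieBracket {F ι : Type*} [NormedAddCommGroup F] [NormedSpace ℝ F] [Fintype ι]
    {f : EuclideanSpace ℝ (Fin 2) → F} {V : ι → F → F} {a b : EuclideanSpace ℝ (Fin 2) → ι → ℝ}
    {x : EuclideanSpace ℝ (Fin 2)} (hf : ContDiffAt ℝ 2 f x)
    (hV : ∀ k, DifferentiableAt ℝ (V k) (f x)) (ha : DifferentiableAt ℝ a x)
    (hb : DifferentiableAt ℝ b x)
    (h0 : ∀ᶠ y in nhds x, pd 0 f y = ∑ k, a y k • V k (f y))
    (h1 : ∀ᶠ y in nhds x, pd 1 f y = ∑ k, b y k • V k (f y)) :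
    ∑ k, (pd 1 a x - pd 0 b x) k • V k (f x)
      = ∑ k, ∑ l, (a x k * b x l) • lieBracket ℝ (V k) (V l) (f x) := by
  have hfd : DifferentiableAt ℝ f x := hf.differentiableAt (by norm_num)
  have key (w : EuclideanSpace ℝ (Fin 2) → ι → ℝ) (hw : DifferentiableAt ℝ w x) (i j : Fin 2)
      (h : ∀ᶠ y in nhds x, pd i f y = ∑ k, w y k • V k (f y)) :
      pd j (pd i f) x = ∑ k, (pd j w x k • V k (f x) + w x k • fderiv ℝ (V k) (f x)
        (pd j f x)) := by
    have e : pd i f =ᶠ[nhds x] fun y => ∑ k, w y k • V k (f y) := h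
    rw [pd_congr e, pd]
    have hd (k : ι) : HasFDerivAt (fun y => w y k • V k (f y))
        (w x k • ((fderiv ℝ (V k) (f x)).comp (fderiv ℝ f x)) +
          (((ContinuousLinearMap.proj k).comp (fderiv ℝ w x)).smulRight (V k (f x)))) x :=
      ((hasFDerivAt_pi'.1 hw.hasFDerivAt) k).fun_smul ((hV k).hasFDerivAt.comp x hfd.hasFDerivAt)
    rw [(HasFDerivAt.fun_sum fun k _ => hd k).fderiv]
    simp [pd, add_comm]
  have hs := pd_comm hf 1 0
  rw [key a ha 0 1 h0, key b hb 1 0 h1, h0.self_of_nhds, h1.self_of_nhds] at hs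
  simp only [Finset.sum_add_distrib, map_sum, map_smul, Finset.smul_sum, smul_smul] at hs
  -- The two double sums run in opposite orders; once aligned, their difference is the bracket.
  rw [Finset.sum_comm (f := fun l k => (b x l * a x k) • fderiv ℝ (V l) (f x) (V k (f x)))] at hs
  simp only [lieBracket, Pi.sub_apply, sub_smul, smul_sub, Finset.sum_sub_distrib]
  rw [sub_eq_sub_iff_add_eq_add, hs, add_comm]
  simp only [mul_comm]

section
variable {M : Type*} [TopologicalSpace M] [ChartedSpace (EuclideanSpace ℝ (Fin 3)) M]
  [Group M] [LieGroup (𝓡 3) ∞ M]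

/-- The Maurer–Cartan equation for the components of the partial derivatives of a map into a Lie
group in a frame of left invariant vector fields. -/
lemma maurer_cartan {E : Fin 3 → GroupLieAlgebra (𝓡 3) M} {ψ : EuclideanSpace ℝ (Fin 2) → M}
    {a b : EuclideanSpace ℝ (Fin 2) → Fin 3 → ℝ}
    {x : EuclideanSpace ℝ (Fin 2)} (hψ : ContMDiffAt 𝓘(ℝ, EuclideanSpace ℝ (Fin 2)) (𝓡 3) 2 ψ x)
    (ha : DifferentiableAt ℝ a x) (hb : DifferentiableAt ℝ b x)
    (h0 : ∀ᶠ y in nhds x, mfderiv 𝓘(ℝ, EuclideanSpace ℝ (Fin 2)) (𝓡 3) ψ y (e 0)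
      = ∑ k, a y k • mulInvariantVectorField (E k) (ψ y))
    (h1 : ∀ᶠ y in nhds x, mfderiv 𝓘(ℝ, EuclideanSpace ℝ (Fin 2)) (𝓡 3) ψ y (e 1)
      = ∑ k, b y k • mulInvariantVectorField (E k) (ψ y)) :
    ∑ k, (pd 1 a x - pd 0 b x) k • mulInvariantVectorField (E k) (ψ x)
      = ∑ k, ∑ l, (a x k * b x l) • mulInvariantVectorField ⁅E k, E l⁆ (ψ x) := by
  set κ := extChartAt (𝓡 3) (ψ x) with hκ
  -- The invariant fields are transported to the chart centred at ψ(x), where the vector space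
  -- version applies. The derivative of this chart at its own base point is the identity, so at ψ(x)
  -- neither the fields nor their brackets change.
  set V : Fin 3 → EuclideanSpace ℝ (Fin 3) → EuclideanSpace ℝ (Fin 3) := fun k =>
    mpullbackWithin 𝓘(ℝ, EuclideanSpace ℝ (Fin 3)) (𝓡 3) κ.symm (mulInvariantVectorField (E k))
      (Set.range (𝓡 3)) with hVdef
  have hr : Set.range (𝓡 3) = Set.univ := ModelWithCorners.range_eq_univ _
  have hVκ (k : Fin 3) (q : M) (hq : q ∈ κ.source) :
      V k (κ q) = mfderiv (𝓡 3) 𝓘(ℝ, EuclideanSpace ℝ (Fin 3)) κ q (mulInvariantVectorField (E k)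
        q) := by
    have e1 := mfderiv_extChartAt_comp_mfderivWithin_extChartAt_symm' (I := 𝓡 3) hq
    have e2 := mfderivWithin_extChartAt_symm_comp_mfderiv_extChartAt' (I := 𝓡 3) hq
    change (mfderivWithin 𝓘(ℝ, EuclideanSpace ℝ (Fin 3)) (𝓡 3) κ.symm (Set.range (𝓡 3))
      (κ q)).inverse
      (mulInvariantVectorField (E k) (κ.symm (κ q))) = _
    have e3 := ContinuousLinearMap.inverse_eq e2 e1
    rw [κ.left_inv hq]
    exact congrArg (fun l => l (mulInvariantVectorField (E k) q)) e3
  have hVx (k : Fin 3) : V k (κ (ψ x)) = mulInvariantVectorField (E k) (ψ x) := by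
    rw [hVκ k _ (mem_extChartAt_source _), hκ, mfderiv_extChartAt_self]
    rfl
  have hVd (k : Fin 3) : DifferentiableAt ℝ (V k) (κ (ψ x)) := by
    have := (mdifferentiableAt_mulInvariantVectorField (I := 𝓡 3) (E k)
      (g := ψ x)).mdifferentiableWithinAt (s := Set.univ)
      |>.differentiableWithinAt_mpullbackWithin_vectorField
    rw [Set.preimage_univ, Set.univ_inter] at this
    exact this.differentiableAt (by rw [hr]; exact Filter.univ_mem)
  have hbr (k l : Fin 3) : lieBracket ℝ (V k) (V l) (κ (ψ x)) = mulInvariantVectorField ⁅E k,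
    E l⁆ (ψ x) := by
    have hinv (w : EuclideanSpace ℝ (Fin 3)) :
        (mfderiv (𝓡 3) 𝓘(ℝ, EuclideanSpace ℝ (Fin 3)) κ (ψ x)).inverse w = w := by
      rw [hκ, mfderiv_extChartAt_self]
      exact congrArg (fun l : EuclideanSpace ℝ (Fin 3) →L[ℝ] EuclideanSpace ℝ (Fin 3) => l w)
        ContinuousLinearMap.inverse_id
    rw [GroupLieAlgebra.bracket_def, mulInvariantVector_mlieBracket, ← mlieBracketWithin_univ,
      mlieBracketWithin_apply]
    refine Eq.trans ?_ (hinv _).symm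
    change _ = lieBracketWithin ℝ (V k) (V l) (κ.symm ⁻¹' Set.univ ∩ Set.range (𝓡 3)) (κ (ψ x))
    rw [Set.preimage_univ, Set.univ_inter, hr, lieBracketWithin_univ]
  have hpd (i : Fin 2) (w : EuclideanSpace ℝ (Fin 2) → Fin 3 → ℝ)
      (h : ∀ᶠ y in nhds x, mfderiv 𝓘(ℝ, EuclideanSpace ℝ (Fin 2)) (𝓡 3) ψ y (e i)
        = ∑ k, w y k • mulInvariantVectorField (E k) (ψ y)) :
      ∀ᶠ y in nhds x, pd i (κ ∘ ψ) y = ∑ k, w y k • V k (κ (ψ y)) := by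
    have hnear : ∀ᶠ y in nhds x, ψ y ∈ κ.source :=
      hψ.continuousAt (extChartAt_source_mem_nhds (I := 𝓡 3) (ψ x))
    have hd : ∀ᶠ y in nhds x, MDifferentiableAt 𝓘(ℝ, EuclideanSpace ℝ (Fin 2)) (𝓡 3) ψ y := by
      filter_upwards [contMDiffAt_iff_contMDiffAt_nhds (by simp) |>.1 hψ] with y hy
        using hy.mdifferentiableAt (by simp)
    filter_upwards [h, hnear, hd] with y hy hyκ hyd
    have hc := mfderiv_comp y (mdifferentiableAt_extChartAt (I := 𝓡 3) (by simpa [hκ] using hyκ))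
      hyd
    rw [mfderiv_eq_fderiv] at hc
    have hc' := congrArg (fun l => l (e i)) hc
    refine hc'.trans ?_
    change mfderiv (𝓡 3) 𝓘(ℝ, EuclideanSpace ℝ (Fin 3)) κ (ψ y)
      (mfderiv 𝓘(ℝ, EuclideanSpace ℝ (Fin 2)) (𝓡 3) ψ y (e i)) = _
    rw [hy, map_sum]
    refine Finset.sum_congr rfl fun k _ => ?_
    rw [map_smul, hVκ k _ hyκ]
    rfl
  have hC : ContDiffAt ℝ 2 (κ ∘ ψ) x := by
    rw [← contMDiffAt_iff_contDiffAt]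
    exact (contMDiffAt_extChartAt (n := 2)).comp x hψ
  have := sum_smul_eq_sum_lieBracket hC hVd ha hb (hpd 0 a h0) (hpd 1 b h1)
  simp only [Function.comp_apply, hVx, hbr] at this
  exact this
end

end

/-! ### Fundamental forms -/

section VectorAlgebra
open Matrix

/-- A vector orthogonal to `a` and `n` is a multiple of `a × n`, determined by its product
with `b`. -/
lemma eq_smul_cross {a b n X : Fin 3 → ℝ} {f : ℝ} (hD : (of ![a, b, n]).det ≠ 0)
    (hXa : X ⬝ᵥ a = 0) (hXb : X ⬝ᵥ b = -f)
    (hXn : X ⬝ᵥ n = 0) : X = (f / (of ![a, b, n]).det) • crossProduct a n := by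
  obtain ⟨r, hr⟩ : ∃ r, r = f / (of ![a, b, n]).det := ⟨_, rfl⟩
  rw [← hr, ← sub_eq_zero]
  rw [eq_div_iff hD, det_fin_three] at hr
  -- The difference is annihilated by the rows a, b, n of an invertible matrix; the middle row uses
  -- b · (a × n) = -det(a, b, n).
  refine eq_zero_of_mulVec_eq_zero hD ?_
  simp only [dotProduct_fin_three] at *
  ext i
  simp only [mulVec, dotProduct_fin_three]
  fin_cases i <;> simp [cross_apply] <;> simp at hr
  · linear_combination hXa
  · linear_combination hXb + hr
  · linear_combination hXn

/-- The squared determinant is the Gram determinant of a, b, n, which reduces to the determinant of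
the first fundamental form. -/
lemma det_sq_eq {a b n : Fin 3 → ℝ} (hnn : n ⬝ᵥ n = 1) (han : a ⬝ᵥ n = 0) (hbn : b ⬝ᵥ n = 0) :
    (of ![a, b, n]).det ^ 2 = (a ⬝ᵥ a) * (b ⬝ᵥ b) - (a ⬝ᵥ b) ^ 2 := by
  have h : (of ![a, b, n]).det ^ 2 = (a ⬝ᵥ a) * (b ⬝ᵥ b) * (n ⬝ᵥ n)
      + 2 * (a ⬝ᵥ b) * (b ⬝ᵥ n) * (a ⬝ᵥ n) - (a ⬝ᵥ a) * (b ⬝ᵥ n) ^ 2 - (b ⬝ᵥ b) * (a ⬝ᵥ n) ^ 2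
      - (n ⬝ᵥ n) * (a ⬝ᵥ b) ^ 2 := by
    rw [det_fin_three]
    simp only [dotProduct_fin_three]
    simp
    ring
  rw [h, hnn, han, hbn]
  ring

/-- Congruence by P multiplies both determinants by (det P)², which cancels in the quotient; `h`
already forces P and A to be invertible. -/
lemma det_inv_mul_of_bilin {A A' T T' : Matrix (Fin 2) (Fin 2) ℝ} (P : Matrix (Fin 2) (Fin 2) ℝ)
    (hA : A' = P * A * Pᵀ) (hT : T' = P * T * Pᵀ) (h : A'.det ≠ 0) :
    (A⁻¹ * T).det = T'.det / A'.det := by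
  subst hA hT
  simp only [det_mul, det_transpose, det_nonsing_inv, Ring.inverse_eq_inv'] at h ⊢
  have hP : P.det ≠ 0 := fun h0 => h (by simp [h0])
  have hA : A.det ≠ 0 := fun h0 => h (by simp [h0])
  field_simp

end VectorAlgebra

/-! ### Bilinearity of the fundamental forms and change of basis. -/

section Forms

variable {M : Type*} [TopologicalSpace M] [ChartedSpace (EuclideanSpace ℝ (Fin 3)) M]
  [Group M] [LieGroup (𝓡 3) ∞ M]
  {S : Type*} [TopologicalSpace S] [ChartedSpace (EuclideanSpace ℝ (Fin 2)) S]
  {m : Metric M} {E : Fin 3 → GroupLieAlgebra (𝓡 3) M} {c : Fin 3 → ℝ} {φ : S → M}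
  {N : ∀ p : S, TangentSpace (𝓡 3) (φ p)}

lemma tangentComp_linear (p : S) (s t : ℝ) (w w' : TangentSpace (𝓡 2) p) :
    tangentComp m E φ p (s • w + t • w') = s • tangentComp m E φ p w
      + t • tangentComp m E φ p w' := by
  ext k
  simp [tangentComp, comp]

lemma covNormal_linear (p : S) (s t : ℝ) (w w' : TangentSpace (𝓡 2) p) :
    covNormal m E φ N p (s • w + t • w') = s • covNormal m E φ N p w
      + t • covNormal m E φ N p w' := by
  ext k
  simp only [covNormal, tangentComp_linear, map_add, map_smul, Pi.add_apply, Pi.smul_apply,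
    smul_eq_mul, add_mul,
    Finset.sum_add_distrib, mul_add, Finset.mul_sum, mul_assoc]
  ring

lemma firstForm_eq (hm : IsLeftInvariant m) (hE : IsUnimodularFrame m E c) (p : S)
    (w w' : TangentSpace (𝓡 2) p) :
    firstForm m φ p w w' = tangentComp m E φ p w ⬝ᵥ tangentComp m E φ p w' :=
  inner_eq_dotProduct hm hE _ _ _

lemma secondForm_eq (p : S) (w w' : TangentSpace (𝓡 2) p) :
    secondForm m E φ N p w w' = -(covNormal m E φ N p w ⬝ᵥ tangentComp m E φ p w') := rfl

lemma eq_smul_e_add (p : S) (w : TangentSpace (𝓡 2) p) :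
    ∃ s t : ℝ, w = s • (e 0 : TangentSpace (𝓡 2) p) + t • (e 1 : TangentSpace (𝓡 2) p) := by
  let w' : EuclideanSpace ℝ (Fin 2) := w
  refine ⟨w' 0, w' 1, ?_⟩
  change w' = w' 0 • e 0 + w' 1 • e 1
  ext i
  fin_cases i <;> simp [e]

/-- The extrinsic curvature can be computed in every basis of the tangent plane. -/
lemma extrinsicCurvature_eq (hm : IsLeftInvariant m) (hE : IsUnimodularFrame m E c) (p : S)
    (w : Fin 2 → TangentSpace (𝓡 2) p)
    (h : firstForm m φ p (w 0) (w 0) * firstForm m φ p (w 1) (w 1)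
      - firstForm m φ p (w 0) (w 1) * firstForm m φ p (w 1) (w 0) ≠ 0) :
    extrinsicCurvature m E φ N p =
      (secondForm m E φ N p (w 0) (w 0) * secondForm m E φ N p (w 1) (w 1)
        - secondForm m E φ N p (w 0) (w 1) * secondForm m E φ N p (w 1) (w 0)) /
      (firstForm m φ p (w 0) (w 0) * firstForm m φ p (w 1) (w 1)
        - firstForm m φ p (w 0) (w 1) * firstForm m φ p (w 1) (w 0)) := by
  choose s t hst using fun i => eq_smul_e_add p (w i)
  -- Both forms are r (F · G) with F, G linear, where r is 1 or -1. Symmetry is not used, since for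
  -- the second form it is not yet available.
  have key (β : TangentSpace (𝓡 2) p → TangentSpace (𝓡 2) p → ℝ)
    (F G : TangentSpace (𝓡 2) p → Fin 3 → ℝ) (r : ℝ)
      (hF : ∀ (s t : ℝ) w w', F (s • w + t • w') = s • F w + t • F w')
      (hG : ∀ (s t : ℝ) w w', G (s • w + t • w') = s • G w + t • G w')
      (hβ : ∀ w w', β w w' = r * (F w ⬝ᵥ G w')) :
      Matrix.of (fun i j => β (w i) (w j)) = (Matrix.of fun i => ![s i, t i]) * Matrix.of
        (fun i j : Fin 2 => β (e i) (e j)) * (Matrix.of fun i => ![s i, t i]).transpose := by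
    have h2 (w : TangentSpace (𝓡 2) p) (v : TangentSpace (𝓡 2) p) (s t s' t' : ℝ) :
        β (s • w + t • v) (s' • w + t' • v) = s * s' * β w w + s * t' * β w v + t * s' * β v w
          + t * t' * β v v := by
      simp only [hβ, hF, hG, add_dotProduct, dotProduct_add, smul_dotProduct, dotProduct_smul,
        smul_eq_mul]
      ring
    ext i j
    simp only [Matrix.mul_apply, Matrix.of_apply, Matrix.transpose_apply, Fin.sum_univ_two]
    refine (congrArg₂ β (hst i) (hst j)).trans ((h2 _ _ _ _ _ _).trans ?_)
    simp
    ring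
  rw [extrinsicCurvature, shapeMatrix, det_inv_mul_of_bilin (Matrix.of fun i => ![s i, t i])
    (key (firstForm m φ p) _ _ 1 (tangentComp_linear p) (tangentComp_linear p)
      (fun w w' => by rw [firstForm_eq hm hE, one_mul]))
    (key (secondForm m E φ N p) _ _ (-1) (covNormal_linear p) (tangentComp_linear p)
      (fun w w' => by rw [secondForm_eq, neg_one_mul]))
    (by simpa [Matrix.det_fin_two] using h)]
  simp [Matrix.det_fin_two]

end Forms

/-! ### Structure equations -/

section

open Matrix

lemma pd_dotProduct {u v : EuclideanSpace ℝ (Fin 2) → Fin 3 → ℝ} {y : EuclideanSpace ℝ (Fin 2)}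
    (hu : DifferentiableAt ℝ u y) (hv : DifferentiableAt ℝ v y) (i : Fin 2) :
    pd i (fun z => u z ⬝ᵥ v z) y = pd i u y ⬝ᵥ v y + u y ⬝ᵥ pd i v y := by
  have hu' := differentiableAt_pi.1 hu
  have hv' := differentiableAt_pi.1 hv
  have e1 (k : Fin 3) : pd i (fun z => u z k * v z k) y = u y k * pd i v y k
    + v y k * pd i u y k := by
    rw [pd, fderiv_fun_mul (hu' k) (hv' k), ← pd_apply hu, ← pd_apply hv]
    rfl
  have e2 : pd i (fun z => u z ⬝ᵥ v z) y = ∑ k, pd i (fun z => u z k * v z k) y := by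
    change fderiv ℝ (fun z => ∑ k, u z k * v z k) y (e i) = _
    rw [fderiv_fun_sum (fun k _ => (hu' k).fun_mul (hv' k)), _root_.sum_apply]
    rfl
  rw [e2, Fin.sum_univ_three, e1, e1, e1, dotProduct_fin_three, dotProduct_fin_three]
  ring

lemma pd_dotProduct_eq_zero {u v : EuclideanSpace ℝ (Fin 2) → Fin 3 → ℝ}
    {y : EuclideanSpace ℝ (Fin 2)} (hu : DifferentiableAt ℝ u y) (hv : DifferentiableAt ℝ v y)
    {t : ℝ} (h : ∀ᶠ z in nhds y, u z ⬝ᵥ v z = t) (i : Fin 2) :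
    pd i u y ⬝ᵥ v y + u y ⬝ᵥ pd i v y = 0 := by
  rw [← pd_dotProduct hu hv, pd_congr h]
  simp [pd]

/-- Structure equations in asymptotic coordinates, at a point: `p`, `q` stand for the partial
derivatives of the Gauss map `n`, and `p + (μ a) × n`, `q + (μ b) × n` for the covariant
derivatives of the normal. -/
lemma asymptotic_eqs {a b n p q da db c : Fin 3 → ℝ} (hp : p ⬝ᵥ n = 0) (hq : q ⬝ᵥ n = 0)
    (hda : da ⬝ᵥ n + a ⬝ᵥ q = 0)
    (hdb : db ⬝ᵥ n + b ⬝ᵥ p = 0) (hc : da - db = fun k => c k * crossProduct a b k)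
    {f : ℝ} (hD : 0 < (of ![a, b, n]).det)
    (huu : (p + crossProduct (fun k => mu c k * a k) n) ⬝ᵥ a = 0)
    (hvv : (q + crossProduct (fun k => mu c k * b k) n) ⬝ᵥ b = 0)
    (huv : (p + crossProduct (fun k => mu c k * a k) n) ⬝ᵥ b = -f) :
    (q + crossProduct (fun k => mu c k * b k) n) ⬝ᵥ a = -f ∧
    p = crossProduct (fun k => (f / (of ![a, b, n]).det - mu c k) * a k) n ∧
    q = crossProduct (fun k => (-(f / (of ![a, b, n]).det) - mu c k) * b k) n := by
  have hcr (d : Fin 3 → ℝ) : crossProduct d n ⬝ᵥ n = 0 := by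
    rw [dotProduct_comm, dot_cross_self]
  -- Symmetry of the second fundamental form: differentiating a · n = 0 in v and b · n = 0 in u
  -- leaves (a_v - b_u) · n = c (a × b) · n, which the connection terms cancel because c₁ = μ₂ + μ₃
  -- and cyclically.
  have hvu : (q + crossProduct (fun k => mu c k * b k) n) ⬝ᵥ a = -f := by
    rw [← huv]
    have h0 := congrFun hc 0
    have h1 := congrFun hc 1
    have h2 := congrFun hc 2
    simp only [dotProduct_fin_three, cross_apply, Pi.sub_apply, Pi.add_apply, mu] at *
    simp at *
    linear_combination hda - hdb - n 0 * h0 - n 1 * h1 - n 2 * h2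
  have hdet : (of ![b, a, n]).det = -(of ![a, b, n]).det := by
    simp [det_fin_three]
    ring
  have hX := eq_smul_cross hD.ne' huu huv (by rw [add_dotProduct, hp, hcr, add_zero])
  -- The roles of a and b are exchanged; the determinant changes sign, which produces -ρ.
  have hY := eq_smul_cross (by rw [hdet]; exact neg_ne_zero.2 hD.ne') hvv hvu
    (by rw [add_dotProduct, hq, hcr, add_zero])
  rw [hdet, div_neg] at hY
  refine ⟨hvu, ?_, ?_⟩
  · rw [eq_sub_of_add_eq hX, ← LinearMap.smul_apply, ← map_smul, ← LinearMap.sub_apply, ← map_sub]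
    congr 2
    ext k
    simp
    ring
  · rw [eq_sub_of_add_eq hY, ← LinearMap.smul_apply, ← map_smul, ← LinearMap.sub_apply, ← map_sub]
    congr 2
    ext k
    simp
    ring

section Structure

variable {M : Type*} [TopologicalSpace M] [ChartedSpace (EuclideanSpace ℝ (Fin 3)) M]
  [Group M] [LieGroup (𝓡 3) ∞ M]
  {S : Type*} [TopologicalSpace S] [ChartedSpace (EuclideanSpace ℝ (Fin 2)) S]
  {m : Metric M} {E : Fin 3 → GroupLieAlgebra (𝓡 3) M} {c : Fin 3 → ℝ} {φ : S → M}
  {N : ∀ p : S, TangentSpace (𝓡 3) (φ p)}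
  {χ : OpenPartialHomeomorph S (EuclideanSpace ℝ (Fin 2))}

lemma normalComp_dotProduct_self (hm : IsLeftInvariant m) (hE : IsUnimodularFrame m E c)
    (hφ : IsImmersionWithNormal m φ N) (p : S) :
    normalComp m E φ N p ⬝ᵥ normalComp m E φ N p = 1 := by
  rw [normalComp, ← inner_eq_dotProduct hm hE, hφ.unit]

lemma tangentComp_dotProduct_normalComp (hm : IsLeftInvariant m) (hE : IsUnimodularFrame m E c)
    (hφ : IsImmersionWithNormal m φ N) (p : S) (w : TangentSpace (𝓡 2) p) :
    tangentComp m E φ p w ⬝ᵥ normalComp m E φ N p = 0 := by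
  rw [normalComp, tangentComp, ← inner_eq_dotProduct hm hE, m.symm, hφ.normal]

/-- The components `a`, `b` of the coordinate vector fields satisfy `a_v - b_u = c (a × b)`. -/
lemma curl_tangentComp (hm : IsLeftInvariant m) (hE : IsUnimodularFrame m E c)
    (hφ : IsImmersionWithNormal m φ N) (hχ : χ ∈ IsManifold.maximalAtlas (𝓡 2) ∞ S)
    {y : EuclideanSpace ℝ (Fin 2)} (hy : y ∈ χ.target) :
    pd 1 (fun y => tangentComp m E φ (χ.symm y) (coordVec χ y 0)) y
      - pd 0 (fun y => tangentComp m E φ (χ.symm y) (coordVec χ y 1)) y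
    = fun k => c k * crossProduct (tangentComp m E φ (χ.symm y) (coordVec χ y 0))
        (tangentComp m E φ (χ.symm y) (coordVec χ y 1)) k := by
  have hd (i : Fin 2) : DifferentiableAt ℝ (fun y => tangentComp m E φ (χ.symm y)
    (coordVec χ y i)) y :=
    ((contDiffOn_tangentComp hφ hχ i).contDiffAt (χ.open_target.mem_nhds hy)).differentiableAt
      (by norm_num)
  have hψ : ContMDiffAt 𝓘(ℝ, EuclideanSpace ℝ (Fin 2)) (𝓡 3) 2 (φ ∘ χ.symm) y :=
    ((hφ.contMDiff.comp_contMDiffOn (contMDiffOn_chart_symm hχ)).contMDiffAt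
      (χ.open_target.mem_nhds hy)).of_le ENat.LEInfty.out
  have hexp (i : Fin 2) : ∀ᶠ z in nhds y,
      mfderiv 𝓘(ℝ, EuclideanSpace ℝ (Fin 2)) (𝓡 3) (φ ∘ χ.symm) z (e i)
        = ∑ k, tangentComp m E φ (χ.symm z) (coordVec χ z i) k
          • mulInvariantVectorField (E k) ((φ ∘ χ.symm) z) := by
    filter_upwards [χ.open_target.mem_nhds hy] with z hz
    rw [← mfderiv_comp_coordVec hφ hχ hz]
    exact (sum_comp_smul hm hE _ _).symm
  have h := maurer_cartan hψ (hd 0) (hd 1) (hexp 0) (hexp 1)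
  ext r
  have hr := congrArg (fun v => m.inner ((φ ∘ χ.symm) y) v (mulInvariantVectorField (E r)
    ((φ ∘ χ.symm) y))) h
  simp only [map_sum, map_smul, _root_.sum_apply, _root_.smul_apply,
    inner_frame hm hE, smul_eq_mul, mul_ite, mul_one, mul_zero, Finset.sum_ite_eq', Finset.mem_univ,
      if_true] at hr
  rw [hr]
  have h10 : ⁅E 1, E 0⁆ = -(c 2 • E 2) := by rw [← lie_skew, hE.lie_zero_one]
  have h21 : ⁅E 2, E 1⁆ = -(c 0 • E 0) := by rw [← lie_skew, hE.lie_one_two]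
  have h02 : ⁅E 0, E 2⁆ = -(c 1 • E 1) := by rw [← lie_skew, hE.lie_two_zero]
  have hl (k l : Fin 3) := hm (φ (χ.symm y)) ⁅E k, E l⁆ (E r)
  simp only [Function.comp_apply, hl]
  fin_cases r <;>
  simp [Fin.sum_univ_three, h10, h21, h02, hE.lie_one_two, hE.lie_two_zero, hE.lie_zero_one,
    hE.orthonormal, cross_apply] <;> ring

lemma covNormal_coordVec (hE : IsUnimodularFrame m E c)
    (hφ : IsImmersionWithNormal m φ N) (hχ : χ ∈ IsManifold.maximalAtlas (𝓡 2) ∞ S)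
    {y : EuclideanSpace ℝ (Fin 2)} (hy : y ∈ χ.target) (i : Fin 2) :
    covNormal m E φ N (χ.symm y) (coordVec χ y i)
      = pd i (fun y => normalComp m E φ N (χ.symm y)) y
        + crossProduct (fun k => mu c k * tangentComp m E φ (χ.symm y) (coordVec χ y i) k)
          (normalComp m E φ N (χ.symm y)) := by
  ext k
  rw [covNormal, mvfderiv_coordVec hφ hχ hy, christoffel_sum hE]
  rfl

end Structure

end

/-! ### Proper null coordinates -/

section

open Matrix

lemma differentiableAt_dotProduct_div_det {n a b p : EuclideanSpace ℝ (Fin 2) → Fin 3 → ℝ}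
    {y : EuclideanSpace ℝ (Fin 2)} (hn : DifferentiableAt ℝ n y) (ha : DifferentiableAt ℝ a y)
    (hb : DifferentiableAt ℝ b y) (hp : DifferentiableAt ℝ p y) (μ : Fin 3 → ℝ)
    (hD : (of ![a y, b y, n y]).det ≠ 0) :
    DifferentiableAt ℝ (fun z => -((p z + crossProduct (fun k => μ k * a z k) (n z)) ⬝ᵥ b z) /
      (of ![a z, b z, n z]).det) y := by
  have hn' := differentiableAt_pi.1 hn
  have ha' := differentiableAt_pi.1 ha
  have hb' := differentiableAt_pi.1 hb
  have hp' := differentiableAt_pi.1 hp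
  have h1 : DifferentiableAt ℝ
      (fun z => (p z + crossProduct (fun k => μ k * a z k) (n z)) ⬝ᵥ b z) y := by
    simp only [dotProduct_fin_three, cross_apply, Pi.add_apply, cons_val]
    fun_prop
  have h2 : DifferentiableAt ℝ (fun z => (of ![a z, b z, n z]).det) y := by
    simp only [det_fin_three, of_apply, cons_val]
    fun_prop
  simp only [div_eq_mul_inv]
  exact h1.fun_neg.fun_mul (h2.fun_inv hD)

section NullChart

variable {M : Type*} [TopologicalSpace M] [ChartedSpace (EuclideanSpace ℝ (Fin 3)) M]
  [Group M] [LieGroup (𝓡 3) ∞ M]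
  {S : Type*} [TopologicalSpace S] [ChartedSpace (EuclideanSpace ℝ (Fin 2)) S]

/-- The positive function `ρ` with `∇_{∂u} N = ρ φ_u × N`, `∇_{∂v} N = -ρ φ_v × N`. -/
def nullFactor (m : Metric M) (E : Fin 3 → GroupLieAlgebra (𝓡 3) M) (φ : S → M)
    (N : ∀ p : S, TangentSpace (𝓡 3) (φ p))
    (χ : OpenPartialHomeomorph S (EuclideanSpace ℝ (Fin 2))) (y : EuclideanSpace ℝ (Fin 2)) : ℝ :=
  secondForm m E φ N (χ.symm y) (coordVec χ y 0) (coordVec χ y 1) /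
    (of ![tangentComp m E φ (χ.symm y) (coordVec χ y 0),
      tangentComp m E φ (χ.symm y) (coordVec χ y 1), normalComp m E φ N (χ.symm y)]).det

variable {m : Metric M} {E : Fin 3 → GroupLieAlgebra (𝓡 3) M} {c : Fin 3 → ℝ} {φ : S → M}
  {N : ∀ p : S, TangentSpace (𝓡 3) (φ p)}
  {χ : OpenPartialHomeomorph S (EuclideanSpace ℝ (Fin 2))} {y : EuclideanSpace ℝ (Fin 2)}

lemma nullFactor_pos (hχ : IsProperNullChart m E φ N χ) (hy : y ∈ χ.target) :
    0 < nullFactor m E φ N χ y :=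
  div_pos (hχ.compatible y hy) (hχ.oriented y hy)

lemma differentiableAt_normalComp (hφ : IsImmersionWithNormal m φ N)
    (hχ : χ ∈ IsManifold.maximalAtlas (𝓡 2) ∞ S) (hy : y ∈ χ.target) :
    DifferentiableAt ℝ (fun y => normalComp m E φ N (χ.symm y)) y :=
  ((contDiffOn_normalComp hφ hχ).contDiffAt (χ.open_target.mem_nhds hy)).differentiableAt
    (by norm_num)

lemma differentiableAt_tangentComp (hφ : IsImmersionWithNormal m φ N)
    (hχ : χ ∈ IsManifold.maximalAtlas (𝓡 2) ∞ S) (hy : y ∈ χ.target) (i : Fin 2) :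
    DifferentiableAt ℝ (fun y => tangentComp m E φ (χ.symm y) (coordVec χ y i)) y :=
  ((contDiffOn_tangentComp hφ hχ i).contDiffAt (χ.open_target.mem_nhds hy)).differentiableAt
    (by norm_num)

/-- On the chart domain ρ is a quotient built from a, b, n and n_u, and n_u is C¹ since n is C². -/
lemma differentiableAt_nullFactor (hE : IsUnimodularFrame m E c)
    (hφ : IsImmersionWithNormal m φ N) (hχ : IsProperNullChart m E φ N χ) (hy : y ∈ χ.target) :
    DifferentiableAt ℝ (nullFactor m E φ N χ) y := by
  have hn := differentiableAt_normalComp (E := E) hφ hχ.mem_maximalAtlas hy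
  have ha := differentiableAt_tangentComp (E := E) hφ hχ.mem_maximalAtlas hy 0
  have hb := differentiableAt_tangentComp (E := E) hφ hχ.mem_maximalAtlas hy 1
  have hp := (contDiffAt_pd ((contDiffOn_normalComp (E := E) hφ
    hχ.mem_maximalAtlas).contDiffAt (χ.open_target.mem_nhds hy)) 0).differentiableAt (by norm_num)
  have hev : nullFactor m E φ N χ =ᶠ[nhds y] fun z =>
      -((pd 0 (fun y => normalComp m E φ N (χ.symm y)) z
        + crossProduct (fun k => mu c k * tangentComp m E φ (χ.symm z) (coordVec χ z 0) k)
          (normalComp m E φ N (χ.symm z))) ⬝ᵥ tangentComp m E φ (χ.symm z) (coordVec χ z 1)) /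
      (of ![tangentComp m E φ (χ.symm z) (coordVec χ z 0),
        tangentComp m E φ (χ.symm z) (coordVec χ z 1), normalComp m E φ N (χ.symm z)]).det := by
    filter_upwards [χ.open_target.mem_nhds hy] with z hz
    rw [nullFactor, secondForm_eq, covNormal_coordVec hE hφ hχ.mem_maximalAtlas hz]
  exact (differentiableAt_dotProduct_div_det hn ha hb hp (mu c)
    (hχ.oriented y hy).ne').congr_of_eventuallyEq hev

/-- In proper null coordinates the second fundamental form is symmetric, and the partial
derivatives of the Gauss map are `n_u = ((ρ - μ) a) × n` and `n_v = ((-ρ - μ) b) × n`. -/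
lemma null_chart_eqs (hm : IsLeftInvariant m) (hE : IsUnimodularFrame m E c)
    (hφ : IsImmersionWithNormal m φ N) (hχ : IsProperNullChart m E φ N χ) (hy : y ∈ χ.target) :
    secondForm m E φ N (χ.symm y) (coordVec χ y 1) (coordVec χ y 0)
      = secondForm m E φ N (χ.symm y) (coordVec χ y 0) (coordVec χ y 1) ∧
    pd 0 (fun y => normalComp m E φ N (χ.symm y)) y = crossProduct
      (fun k => (nullFactor m E φ N χ y - mu c k) * tangentComp m E φ (χ.symm y) (coordVec χ y 0) k)
      (normalComp m E φ N (χ.symm y)) ∧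
    pd 1 (fun y => normalComp m E φ N (χ.symm y)) y = crossProduct
      (fun k => (-nullFactor m E φ N χ y - mu c k) * tangentComp m E φ (χ.symm y)
        (coordVec χ y 1) k)
      (normalComp m E φ N (χ.symm y)) := by
  have hn := differentiableAt_normalComp (E := E) hφ hχ.mem_maximalAtlas hy
  have ht (i : Fin 2) := differentiableAt_tangentComp (E := E) hφ hχ.mem_maximalAtlas hy i
  have hnn (i : Fin 2) := pd_dotProduct_eq_zero hn hn
    (.of_forall fun z => normalComp_dotProduct_self hm hE hφ (χ.symm z)) i
  have htn (i j : Fin 2) := pd_dotProduct_eq_zero (ht i) hn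
    (.of_forall fun z => tangentComp_dotProduct_normalComp hm hE hφ (χ.symm z) _) j
  have hnn' (i : Fin 2) : pd i (fun y => normalComp m E φ N (χ.symm y)) y
      ⬝ᵥ normalComp m E φ N (χ.symm y) = 0 := by
    have := hnn i
    rw [dotProduct_comm (normalComp m E φ N (χ.symm y))] at this
    linarith
  have huu := hχ.null_u y hy
  have hvv := hχ.null_v y hy
  simp only [secondForm_eq, covNormal_coordVec hE hφ hχ.mem_maximalAtlas hy, neg_eq_zero]
    at huu hvv
  have h := asymptotic_eqs (hnn' 0) (hnn' 1) (htn 0 1) (htn 1 0)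
    (curl_tangentComp hm hE hφ hχ.mem_maximalAtlas hy) (hχ.oriented y hy) huu hvv
    (f := secondForm m E φ N (χ.symm y) (coordVec χ y 0) (coordVec χ y 1))
    (by rw [secondForm_eq, covNormal_coordVec hE hφ hχ.mem_maximalAtlas hy, neg_neg])
  refine ⟨?_, h.2⟩
  rw [secondForm_eq, covNormal_coordVec hE hφ hχ.mem_maximalAtlas hy, h.1, neg_neg]

/-- In the basis φ_u, φ_v the second form is antidiagonal with both entries f, so its determinant is
-f², while the first form has determinant det(a, b, n)². -/
lemma extrinsicCurvature_eq_neg_sq (hm : IsLeftInvariant m) (hE : IsUnimodularFrame m E c)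
    (hφ : IsImmersionWithNormal m φ N) (hχ : IsProperNullChart m E φ N χ) (hy : y ∈ χ.target) :
    extrinsicCurvature m E φ N (χ.symm y) = -nullFactor m E φ N χ y ^ 2 := by
  have hD := (hχ.oriented y hy).ne'
  have hsq := det_sq_eq (normalComp_dotProduct_self hm hE hφ (χ.symm y))
    (tangentComp_dotProduct_normalComp hm hE hφ (χ.symm y) (coordVec χ y 0))
    (tangentComp_dotProduct_normalComp hm hE hφ (χ.symm y) (coordVec χ y 1))
  have hI : firstForm m φ (χ.symm y) (coordVec χ y 0) (coordVec χ y 0)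
        * firstForm m φ (χ.symm y) (coordVec χ y 1) (coordVec χ y 1)
      - firstForm m φ (χ.symm y) (coordVec χ y 0) (coordVec χ y 1)
        * firstForm m φ (χ.symm y) (coordVec χ y 1) (coordVec χ y 0)
      = (of ![tangentComp m E φ (χ.symm y) (coordVec χ y 0),
        tangentComp m E φ (χ.symm y) (coordVec χ y 1), normalComp m E φ N (χ.symm y)]).det ^ 2 := by
    simp only [firstForm_eq hm hE, hsq]
    rw [dotProduct_comm (tangentComp m E φ (χ.symm y) (coordVec χ y 1))
      (tangentComp m E φ (χ.symm y) (coordVec χ y 0))]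
    ring
  rw [extrinsicCurvature_eq hm hE _ (coordVec χ y) (by rw [hI]; exact pow_ne_zero 2 hD), hI,
    hχ.null_u y hy, (null_chart_eqs hm hE hφ hχ hy).1, nullFactor]
  field_simp
  ring

end NullChart

end

end UnimodularSurface

end

open UnimodularSurface in
theorem theorem4p4
    {M : Type*} [TopologicalSpace M] [ChartedSpace (EuclideanSpace ℝ (Fin 3)) M]
    [Group M] [LieGroup (𝓡 3) ∞ M]
    (m : Metric M) (hm : IsLeftInvariant m)
    (E : Fin 3 → GroupLieAlgebra (𝓡 3) M) (c : Fin 3 → ℝ) (hE : IsUnimodularFrame m E c)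
    (hμ : mu c 0 = mu c 1)
    {S : Type*} [TopologicalSpace S] [ChartedSpace (EuclideanSpace ℝ (Fin 2)) S]
    [IsManifold (𝓡 2) ∞ S]
    (φ : S → M) (N : ∀ p : S, TangentSpace (𝓡 3) (φ p)) (hφ : IsImmersionWithNormal m φ N)
    (hK : ∀ p, extrinsicCurvature m E φ N p < 0)
    (hK₁ : ∀ p, extrinsicCurvature m E φ N p ≠ -(mu c 0) ^ 2)
    (hK₂ : ∀ p, normalComp m E φ N p 2 ≠ 1 →
      extrinsicCurvature m E φ N p ≠
        -((-1 + ‖gaussMap m E φ N p‖ ^ 2) ^ 2 * mu c 0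
            + 4 * ‖gaussMap m E φ N p‖ ^ 2 * mu c 2) ^ 2 /
          (1 + ‖gaussMap m E φ N p‖ ^ 2) ^ 4)
    (χ : OpenPartialHomeomorph S (EuclideanSpace ℝ (Fin 2)))
    (hχ : IsProperNullChart m E φ N χ)
    (g gbar : EuclideanSpace ℝ (Fin 2) → ℂ) (K : EuclideanSpace ℝ (Fin 2) → ℝ)
    (hg : ∀ y, g y = gaussMap m E φ N (χ.symm y)) (hgbar : ∀ y, gbar y = star (g y))
    (hKχ : ∀ y, K y = extrinsicCurvature m E φ N (χ.symm y))
    (x : EuclideanSpace ℝ (Fin 2)) (hx : x ∈ χ.target)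
    (hx' : normalComp m E φ N (χ.symm x) 2 ≠ 1) :
    pd 1 (pd 0 g) x =
      G₁ (mu c 0) (mu c 2) (g x) (K x) * pd 0 g x * pd 1 g x
      + G₂ (mu c 0) (mu c 2) (g x) (K x) * pd 0 g x * pd 1 gbar x
      + G₃ (mu c 0) (mu c 2) (g x) (K x) * pd 0 gbar x * pd 1 g x
      + G₄ (mu c 0) (mu c 2) (g x) (K x) * pd 0 gbar x * pd 1 gbar x
      + G₅ (mu c 0) (mu c 2) (g x) (K x) * ((pd 0 K x : ℝ) : ℂ) * pd 1 g x
      + G₆ (mu c 0) (mu c 2) (g x) (K x) * ((pd 0 K x : ℝ) : ℂ) * pd 1 gbar x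
      + G₇ (mu c 0) (mu c 2) (g x) (K x) * ((pd 1 K x : ℝ) : ℂ) * pd 0 g x
      + G₈ (mu c 0) (mu c 2) (g x) (K x) * ((pd 1 K x : ℝ) : ℂ) * pd 0 gbar x := by
  have hχ' := hχ.mem_maximalAtlas
  set n := fun y => normalComp m E φ N (χ.symm y) with hndef
  have hnC : ContDiffOn ℝ 2 n χ.target := contDiffOn_normalComp hφ hχ'
  -- The coordinate equations are used on the open part of the chart where g is finite.
  have hU : IsOpen (χ.target ∩ {y | n y 2 ≠ 1}) :=
    (continuousOn_pi.1 hnC.continuousOn 2).isOpen_inter_preimage χ.open_target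
      (isOpen_compl_singleton (x := (1 : ℝ)))
  have hμk (k : Fin 3) : mu c k = ![mu c 0, mu c 0, mu c 2] k := by
    fin_cases k <;> simp [hμ]
  have hck (k : Fin 3) : c k = ![mu c 0 + mu c 2, mu c 0 + mu c 2, 2 * mu c 0] k := by
    have : c 0 = c 1 := by
      simp only [mu, Matrix.cons_val_zero, Matrix.cons_val_one] at hμ
      linarith
    fin_cases k <;> simp [mu] <;> linarith
  have hKρ (y) (hy : y ∈ χ.target) : K y = -nullFactor m E φ N χ y ^ 2 := by
    rw [hKχ, extrinsicCurvature_eq_neg_sq hm hE hφ hχ hy]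
  have hρ := differentiableAt_nullFactor hE hφ hχ hx
  have hpdK (i : Fin 2) :
      pd i K x = -2 * nullFactor m E φ N χ x * pd i (nullFactor m E φ N χ) x := by
    rw [← pd_neg_sq hρ]
    exact pd_congr (Filter.eventually_of_mem (χ.open_target.mem_nhds hx) hKρ)
  have hgd : DifferentiableAt ℝ g x := by
    have hn := differentiableAt_pi.1 (differentiableAt_normalComp (E := E) hφ hχ' hx)
    have hn' (k : Fin 3) : DifferentiableAt ℝ (fun y => (normalComp m E φ N (χ.symm y) k : ℂ)) x :=
      Complex.ofRealCLM.differentiableAt.comp x (hn k)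
    have hg' : g = fun y => ((normalComp m E φ N (χ.symm y) 0 : ℂ)
        + Complex.I * (normalComp m E φ N (χ.symm y) 1 : ℂ)) /
          (1 - (normalComp m E φ N (χ.symm y) 2 : ℂ)) := funext hg
    rw [hg']
    simp only [div_eq_mul_inv]
    exact ((hn' 0).fun_add ((hn' 1).const_mul Complex.I)).fun_mul
      (((hn' 2).const_sub 1).fun_inv (sub_ne_zero.2 fun h => hx' (by exact_mod_cast h.symm)))
  have hpdg (i : Fin 2) : pd i gbar x = (starRingEnd ℂ) (pd i g x) := by
    rw [← pd_conj hgd]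
    exact pd_congr (.of_forall hgbar)
  rw [hpdK, hpdK, hpdg, hpdg, hKρ x hx]
  refine pd_pd_gaussMap_eq hU ⟨hx, hx'⟩ (hnC.mono Set.inter_subset_left)
    (differentiableAt_tangentComp (E := E) hφ hχ' hx 0)
    (differentiableAt_tangentComp (E := E) hφ hχ' hx 1) hρ (nullFactor_pos hχ hx)
    (fun y _ => hg y) (fun y hy => hy.2)
    (fun y _ => normalComp_dotProduct_self hm hE hφ _)
    (fun y _ => tangentComp_dotProduct_normalComp hm hE hφ _ _)
    (fun y _ => tangentComp_dotProduct_normalComp hm hE hφ _ _)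
    (fun y hy => by simpa only [← hμk] using (null_chart_eqs hm hE hφ hχ hy.1).2.1)
    (fun y hy => by simpa only [← hμk] using (null_chart_eqs hm hE hφ hχ hy.1).2.2)
    ((curl_tangentComp hm hE hφ hχ' hx).trans (by simp only [← hck])) ?_
  have h1 : (mu c 0) ^ 2 - nullFactor m E φ N χ x ^ 2 ≠ 0 := fun h => by
    refine hK₁ (χ.symm x) ?_
    rw [← hKχ, hKρ x hx]
    linarith
  -- With t = |g|², (t - 1)² μ₁ + 4t μ₃ = μ₁(1 + t)² - 4(μ₁ - μ₃)t = Q, so this is the condition Q²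
  -- + B⁴K ≠ 0.
  have h2 : (mu c 0 * (1 + ‖g x‖ ^ 2) ^ 2 - 4 * (mu c 0 - mu c 2) * ‖g x‖ ^ 2) ^ 2
      - (1 + ‖g x‖ ^ 2) ^ 4 * nullFactor m E φ N χ x ^ 2 ≠ 0 := fun h => by
    refine hK₂ (χ.symm x) hx' ?_
    rw [← hKχ, hKρ x hx, ← hg, eq_div_iff (by positivity)]
    linear_combination h
  rw [Complex.mul_conj, Complex.normSq_eq_norm_sq]
  exact_mod_cast mul_ne_zero h1 h2
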